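/- Let $n\ge 2$, let $(S^n,g)\subset\mathbb R^{n+1}$ be the unit sphere with its standard metric, and let $(x^1,\dots,x^n)$ be a coordinate system on an open set $U\subset S^n$ that is conformally flat: $g=\lambda^2\sum_i dx^i\otimes dx^i$ on $U$ with $\lambda>0$. Put $\mu_i=\frac1\lambda\frac{\partial\lambda}{\partial x^i}$, and let $(x^1,\dots,x^n,y^1,\dots,y^n)$ be the associated coordinates on $TU$, so that $(x,y)$ stands for the tangent vector $\sum_i y^i\,\partial/\partial x^i$ at the point with coordinates $x$. Let $\alpha,\delta,\sigma:TU\to\mathbb R$ be smooth functions with $\alpha\delta-\sigma^2=1$, and let $J_{\delta,\sigma}$ be the isotropic almost complex structure on $TU$ given by $$J_{\delta,\sigma}X^h=\alpha X^v+\sigma X^h,\qquad J_{\delta,\sigma}X^v=-\sigma X^v-\delta X^h,$$ where $X^h$ and $X^v$ are the horizontal and vertical lifts with respect to the Levi-Civita connection of $g$. Put $z=\frac{\sigma+\sqrt{-1}}{\delta}:TU\to\mathbb C$. Then $J_{\delta,\sigma}$ is integrable on $TU$ (that is, the Lie bracket of any two smooth sections over $TU$ of $T^{(0,1)}=\{X+\sqrt{-1}\,J_{\delta,\sigma}X\}$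 is again a section of $T^{(0,1)}$) if and only if $$\sum_{i=1}^n\Big[\frac{\partial z}{\partial y^i}\big(y^{s_0}\mu_i-\mu_{s_0}y^i\big)-\frac{\partial z}{\partial y^{s_0}}\,y^i\mu_i\Big]=-\,y^{s_0}\lambda^2-\Big(\frac{\partial z}{\partial x^{s_0}}+z\frac{\partial z}{\partial y^{s_0}}\Big)$$ holds on all of $TU$ for every $s_0$ with $1\le s_0\le n$. -/

import Mathlib

open scoped Manifold ContDiff

noncomputable section

/-! ### Integrability of an almost complex structure -/

section Integrability

variable {E : Type*} [NormedAddCommGroup E] [NormedSpace ℝ E]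
  {H : Type*} [TopologicalSpace H] (I : ModelWithCorners ℝ E H)
  (M : Type*) [TopologicalSpace M] [ChartedSpace H M] [IsManifold I 1 M]

/-- A section `re + √-1 im` of the complexified tangent bundle of `M`. -/
structure CVectorField where
  re : ∀ p : M, TangentSpace I p
  im : ∀ p : M, TangentSpace I p

variable {I M}

/-- The complex bilinear extension of the Lie bracket of vector fields. -/
def CVectorField.bracket (A B : CVectorField I M) : CVectorField I M where
  re := fun p => VectorField.mlieBracket I A.re B.re p - VectorField.mlieBracket I A.im B.im p
  im := fun p => VectorField.mlieBracket I A.re B.im p + VectorField.mlieBracket I A.im B.re p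

/-- Smoothness of a complex vector field on the set `s`. -/
def CVectorField.SmoothOn (A : CVectorField I M) (s : Set M) : Prop :=
  ContMDiffOn I I.tangent ∞ (fun p => (⟨p, A.re p⟩ : TangentBundle I M)) s ∧
    ContMDiffOn I I.tangent ∞ (fun p => (⟨p, A.im p⟩ : TangentBundle I M)) s

/-- `A p ∈ T_p^{(0,1)} = {X + √-1 J X | X ∈ T_p M}` for every `p ∈ s`. -/
def CVectorField.IsType01On (J : ∀ p : M, TangentSpace I p →L[ℝ] TangentSpace I p)
    (A : CVectorField I M) (s : Set M) : Prop :=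
  ∀ p ∈ s, ∃ X : TangentSpace I p, A.re p = X ∧ A.im p = J p X

/-- `J` is integrable on `s` (an open set): the bracket of two smooth sections of `T^{(0,1)}`
over `s` is again a section of `T^{(0,1)}`. -/
def IsIntegrableOn (J : ∀ p : M, TangentSpace I p →L[ℝ] TangentSpace I p) (s : Set M) : Prop :=
  ∀ A B : CVectorField I M, A.SmoothOn s → B.SmoothOn s →
    A.IsType01On J s → B.IsType01On J s → (A.bracket B).IsType01On J s

end Integrability

/-! ### The tangent bundle of the unit sphere -/

/-- The unit sphere `S^n ⊂ ℝ^{n+1}`. -/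
abbrev Sph (n : ℕ) : Type := Metric.sphere (0 : EuclideanSpace ℝ (Fin (n + 1))) 1

/-- The tangent bundle `TS^n`. -/
abbrev TSph (n : ℕ) : Type := TangentBundle (𝓡 n) (Sph n)

variable {n : ℕ}

/-- The differential at `p` of the inclusion `S^n ⊂ ℝ^{n+1}`; it identifies `T_p S^n` with `p^⊥`. -/
def dIncl (p : Sph n) : TangentSpace (𝓡 n) p →L[ℝ] EuclideanSpace ℝ (Fin (n + 1)) :=
  mvfderiv (𝓡 n) (fun q : Sph n => (q : EuclideanSpace ℝ (Fin (n + 1)))) p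

/-- The standard (round) metric of `S^n`. -/
def roundMetric (p : Sph n) (v w : TangentSpace (𝓡 n) p) : ℝ :=
  inner ℝ (dIncl p v) (dIncl p w)

/-- A point `(p, v)` of `TS^n` is sent to its tangent vector `v`, as a vector of `ℝ^{n+1}`. -/
def fibreVector (w : TSph n) : EuclideanSpace ℝ (Fin (n + 1)) := dIncl w.proj w.2

/-- The orthogonal projection of `ℝ^{n+1}` onto `T_p S^n = p^⊥`. -/
def tangentialPart (p : Sph n) (a : EuclideanSpace ℝ (Fin (n + 1))) :
    EuclideanSpace ℝ (Fin (n + 1)) :=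
  a - inner ℝ (p : EuclideanSpace ℝ (Fin (n + 1))) a • (p : EuclideanSpace ℝ (Fin (n + 1)))

/-- The differential of the projection `π : TS^n → S^n`. -/
def dProj (w : TSph n) :
    TangentSpace (𝓡 n).tangent w →L[ℝ] TangentSpace (𝓡 n) w.proj :=
  mfderiv (𝓡 n).tangent (𝓡 n) (fun w' : TSph n => w'.proj) w

/-- The connection map `K : TTS^n → TS^n` of the Levi-Civita connection of the round metric, with
values written in `T_p S^n = p^⊥ ⊂ ℝ^{n+1}`. The Levi-Civita derivative on `S^n` is the tangential
part of the derivative in `ℝ^{n+1}`, so that `K` sends the velocity of a curve `(p(t), v(t))` in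
`TS^n` to the tangential part of `v'(t)`. In particular `K (X_* V) = ∇_V X`. -/
def connectionMap (w : TSph n) (ξ : TangentSpace (𝓡 n).tangent w) :
    EuclideanSpace ℝ (Fin (n + 1)) :=
  tangentialPart w.proj (mvfderiv (𝓡 n).tangent (fun w' : TSph n => fibreVector w') w ξ)

/-- `ξ` is the horizontal lift `X^h` of `X` to `w`: it is in the kernel of `K` and lies over `X`. -/
def IsHorizontalLift (w : TSph n) (X : TangentSpace (𝓡 n) w.proj)
    (ξ : TangentSpace (𝓡 n).tangent w) : Prop :=
  connectionMap w ξ = 0 ∧ dProj w ξ = X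

/-- `ξ` is the vertical lift `X^v` of `X` to `w`: it is in the kernel of `π_*` and `K ξ = X`. -/
def IsVerticalLift (w : TSph n) (X : TangentSpace (𝓡 n) w.proj)
    (ξ : TangentSpace (𝓡 n).tangent w) : Prop :=
  dProj w ξ = 0 ∧ connectionMap w ξ = dIncl w.proj X

/-- `J` is, on the open set `s ⊆ TS^n`, the isotropic almost complex structure `J_{δ,σ}` given by
the smooth functions `α, δ, σ : s → ℝ` with `αδ - σ² = 1`:
`J X^h = α X^v + σ X^h` and `J X^v = -σ X^v - δ X^h`. As the horizontal and vertical lifts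
span the tangent space, these equations determine `J` on `s` and imply `J² = -1`. -/
structure IsIsotropicOn (J : ∀ w : TSph n,
      TangentSpace (𝓡 n).tangent w →L[ℝ] TangentSpace (𝓡 n).tangent w)
    (α δ σ : TSph n → ℝ) (s : Set (TSph n)) : Prop where
  smooth_α : ContMDiffOn (𝓡 n).tangent 𝓘(ℝ, ℝ) ∞ α s
  smooth_δ : ContMDiffOn (𝓡 n).tangent 𝓘(ℝ, ℝ) ∞ δ s
  smooth_σ : ContMDiffOn (𝓡 n).tangent 𝓘(ℝ, ℝ) ∞ σ s
  det_eq_one : ∀ w ∈ s, α w * δ w - σ w ^ 2 = 1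
  map_horizontal : ∀ w ∈ s, ∀ X ξ η, IsHorizontalLift w X ξ → IsVerticalLift w X η →
    J w ξ = α w • η + σ w • ξ
  map_vertical : ∀ w ∈ s, ∀ X ξ η, IsHorizontalLift w X ξ → IsVerticalLift w X η →
    J w η = -(σ w • η) - δ w • ξ

/-- The function `z = (σ + √-1) / δ`. -/
def zFun (δ σ : TSph n → ℝ) (w : TSph n) : ℂ := ((σ w : ℂ) + Complex.I) / (δ w : ℂ)

/-! ### Coordinates -/

/-- The part `TU = π⁻¹(U)` of `TS^n` over `U`. -/
def bundleOver (U : Set (Sph n)) : Set (TSph n) := {w | w.proj ∈ U}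

/-- In the coordinates `x` on `U` given by the chart `e`, the metric is `lam² ∑ dx^i ⊗ dx^i`,
with the conformal factor `lam > 0`. -/
def IsConformallyFlatChart (e : OpenPartialHomeomorph (Sph n) (EuclideanSpace ℝ (Fin n)))
    (lam : Sph n → ℝ) : Prop :=
  e ∈ IsManifold.maximalAtlas (𝓡 n) ∞ (Sph n) ∧
  ∀ p ∈ e.source, 0 < lam p ∧ ∀ v w : TangentSpace (𝓡 n) p,
    roundMetric p v w = lam p ^ 2 * ∑ i, mvfderiv (𝓡 n) e p v i * mvfderiv (𝓡 n) e p w i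

/-- The point `∑ y^i ∂/∂x^i` of `TS^n` at the point of `S^n` with coordinates `x`: the inverse of
the coordinate system `(x, y)` on `TU` associated with the chart `e`. -/
def bundlePoint (e : OpenPartialHomeomorph (Sph n) (EuclideanSpace ℝ (Fin n)))
    (q : EuclideanSpace ℝ (Fin n) × EuclideanSpace ℝ (Fin n)) : TSph n :=
  ⟨e.symm q.1, mfderiv 𝓘(ℝ, EuclideanSpace ℝ (Fin n)) (𝓡 n) e.symm q.1 q.2⟩

/-- The function `z` in the coordinates `(x, y)` on `TU` associated with the chart `e`. -/
def zCoord (e : OpenPartialHomeomorph (Sph n) (EuclideanSpace ℝ (Fin n))) (δ σ : TSph n → ℝ)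
    (q : EuclideanSpace ℝ (Fin n) × EuclideanSpace ℝ (Fin n)) : ℂ :=
  zFun δ σ (bundlePoint e q)

/-- `∂f/∂x^i` for a function `f` of the coordinates `(x, y)`. -/
def partialX (i : Fin n) (f : EuclideanSpace ℝ (Fin n) × EuclideanSpace ℝ (Fin n) → ℂ)
    (q : EuclideanSpace ℝ (Fin n) × EuclideanSpace ℝ (Fin n)) : ℂ :=
  fderiv ℝ f q (EuclideanSpace.single i 1, 0)

/-- `∂f/∂y^i` for a function `f` of the coordinates `(x, y)`. -/
def partialY (i : Fin n) (f : EuclideanSpace ℝ (Fin n) × EuclideanSpace ℝ (Fin n) → ℂ)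
    (q : EuclideanSpace ℝ (Fin n) × EuclideanSpace ℝ (Fin n)) : ℂ :=
  fderiv ℝ f q (0, EuclideanSpace.single i 1)

/-- `μ_i = (1/λ) ∂λ/∂x^i`, in the coordinates given by the chart `e`. -/
def muCoeff (e : OpenPartialHomeomorph (Sph n) (EuclideanSpace ℝ (Fin n))) (lam : Sph n → ℝ)
    (i : Fin n) (x : EuclideanSpace ℝ (Fin n)) : ℝ :=
  fderiv ℝ (fun x' => lam (e.symm x')) x (EuclideanSpace.single i 1) / lam (e.symm x)

end

/-! For sections V + √-1 JV and W + √-1 JW of T^{(0,1)}, the imaginary part of the bracket minus J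
of its real part is a Nijenhuis expression N(V, W), which is tensorial because J² = -1.
Integrability is therefore the pointwise vanishing of N, and it can be tested in the coordinates (x,
y) on TU.

Differentiating J² = -1 gives N(JX, Y) = -J N(X, Y). Since αδ - σ² = 1 forces δ ≠ 0, vertical
vectors and their images under J span every tangent space, so N need only vanish on vertical pairs.
There J(0, v) is explicit in terms of δ, σ and the Christoffel operator Γ of the conformally flat
metric. The terms quadratic in Γ and linear in its derivatives assemble into the curvature tensor.
Because the sphere has curvature one, this contributes only multiples of λ²(⟨u, y⟩v - ⟨v, y⟩u), and
N(u^v, v^v) has horizontal part A(u)v - A(v)u and vertical part B(u)v - B(v)u for two linear forms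
A, B. When n ≥ 2 both parts vanish for all u, v exactly if A = B = 0
(`nijenhuis_isotropicEndo_eq_zero_iff`).

The pair A = B = 0 is an invertible recombination of the complex equation u^h z + z u^v z + λ²⟨u, y⟩
= 0 (`isotropic_equations_iff`). Writing u^h in coordinates yields the stated system.

The geometry comes from F, the inverse chart followed by the inclusion in ℝ^{n+1}. Its second
derivative gives the Gauss formula, hence the coordinate form of the lifts
(`connectionMap_dBundlePoint`); symmetry of its third derivative gives the curvature
(`gauss_equation`). -/

noncomputable section

/-! ### The Nijenhuis tensor on a vector space. -/

section Nijenhuis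

variable {G : Type*} [NormedAddCommGroup G] [NormedSpace ℝ G]

/-- Half of the Nijenhuis tensor of the endomorphism field `J`, before antisymmetrization. -/
def nijenhuisHalf (J : G → G →L[ℝ] G) (q X Y : G) : G :=
  fderiv ℝ J q X Y + J q (fderiv ℝ J q (J q X) Y)

/-- The Nijenhuis tensor of the endomorphism field `J` on a vector space. -/
def nijenhuis (J : G → G →L[ℝ] G) (q X Y : G) : G :=
  nijenhuisHalf J q X Y - nijenhuisHalf J q Y X

/-- The left side is the obstruction for the bracket of V + √-1 JV and W + √-1 JW to have type
(0,1). By the product rule and J² = -1 all derivatives of V and W cancel, leaving only those of J.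
-/
theorem lieBracket_endo_eq_nijenhuis {J : G → G →L[ℝ] G} {q : G} {V W JV JW : G → G}
    (hJ : DifferentiableAt ℝ J q) (hsq : ∀ v, J q (J q v) = -v)
    (hV : DifferentiableAt ℝ V q) (hW : DifferentiableAt ℝ W q)
    (hJV : JV =ᶠ[nhds q] fun x => J x (V x)) (hJW : JW =ᶠ[nhds q] fun x => J x (W x)) :
    VectorField.lieBracket ℝ V JW q + VectorField.lieBracket ℝ JV W q
      - J q (VectorField.lieBracket ℝ V W q - VectorField.lieBracket ℝ JV JW q)
      = nijenhuis J q (V q) (W q) := by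
  have key : ∀ {U JU : G → G}, DifferentiableAt ℝ U q → (JU =ᶠ[nhds q] fun x => J x (U x)) →
      (JU q = J q (U q) ∧ ∀ v, fderiv ℝ JU q v = J q (fderiv ℝ U q v) + fderiv ℝ J q v (U q)) := by
    intro U JU hU hJU
    refine ⟨hJU.self_of_nhds, fun v => ?_⟩
    rw [hJU.fderiv_eq, (hJ.hasFDerivAt.clm_apply hU.hasFDerivAt).fderiv]
    simp
  obtain ⟨e1, d1⟩ := key hV hJV
  obtain ⟨e2, d2⟩ := key hW hJW
  simp only [VectorField.lieBracket, nijenhuis, nijenhuisHalf, d1, d2, e1, e2, map_sub, map_add, hsq]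
  abel

variable {J : G → G →L[ℝ] G} {q : G}

theorem nijenhuis_antisymm (X Y : G) : nijenhuis J q Y X = -nijenhuis J q X Y := by
  simp [nijenhuis]

theorem nijenhuis_add_left (X X' Y : G) :
    nijenhuis J q (X + X') Y = nijenhuis J q X Y + nijenhuis J q X' Y := by
  simp only [nijenhuis, nijenhuisHalf, map_add, add_apply]
  abel

/-- Differentiating J² = -1 shows that every derivative of J anticommutes with J. -/
theorem nijenhuis_endo_left (hJ : DifferentiableAt ℝ J q)
    (hsq : ∀ᶠ x in nhds q, ∀ v, J x (J x v) = -v) (X Y : G) :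
    nijenhuis J q (J q X) Y = -J q (nijenhuis J q X Y) := by
  have h0 := hsq.self_of_nhds
  have anti : ∀ v w, fderiv ℝ J q v (J q w) = -J q (fderiv ℝ J q v w) := by
    intro v w
    have h1 : HasFDerivAt (fun x => J x (J x w)) (0 : G →L[ℝ] G) q :=
      (hasFDerivAt_const (-w) q).congr_of_eventuallyEq (hsq.mono fun x hx => hx w)
    have h2 := hJ.hasFDerivAt.clm_apply (hJ.hasFDerivAt.clm_apply (hasFDerivAt_const w q))
    have := congrArg (fun L => L v) (h2.unique h1)
    simp at this
    rw [eq_neg_iff_add_eq_zero, add_comm]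
    exact this
  simp only [nijenhuis, nijenhuisHalf, h0, anti, map_neg, map_sub, map_add, neg_apply]
  abel

theorem nijenhuis_eq_zero_of_forall_mem (hJ : DifferentiableAt ℝ J q)
    (hsq : ∀ᶠ x in nhds q, ∀ v, J x (J x v) = -v) (S : Set G)
    (hS : ∀ v, ∃ a ∈ S, ∃ b ∈ S, v = a + J q b)
    (h : ∀ a ∈ S, ∀ b ∈ S, nijenhuis J q a b = 0) (X Y : G) : nijenhuis J q X Y = 0 := by
  have h1 : ∀ X, ∀ b ∈ S, nijenhuis J q X b = 0 := by
    intro X b hb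
    obtain ⟨a, ha, a', ha', rfl⟩ := hS X
    rw [nijenhuis_add_left, nijenhuis_endo_left hJ hsq, h a ha b hb, h a' ha' b hb]
    simp
  obtain ⟨a, ha, a', ha', rfl⟩ := hS Y
  rw [nijenhuis_antisymm, nijenhuis_add_left, nijenhuis_endo_left hJ hsq, nijenhuis_antisymm,
    h1 _ a ha, nijenhuis_antisymm, h1 _ a' ha']
  simp

end Nijenhuis

/-! ### Integrability on a manifold, read in a parametrization. -/

section Transfer

open VectorField

variable {G : Type*} [NormedAddCommGroup G] [NormedSpace ℝ G] [CompleteSpace G]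
  {H : Type*} [TopologicalSpace H] {I : ModelWithCorners ℝ G H}
  {M : Type*} [TopologicalSpace M] [ChartedSpace H M] [IsManifold I ∞ M]

theorem isInvertible_mfderiv_of_local_inverse
    {G₁ G₂ H₁ H₂ M₁ M₂ : Type*} [NormedAddCommGroup G₁] [NormedSpace ℝ G₁]
    [NormedAddCommGroup G₂] [NormedSpace ℝ G₂] [TopologicalSpace H₁] [TopologicalSpace H₂]
    {I₁ : ModelWithCorners ℝ G₁ H₁} {I₂ : ModelWithCorners ℝ G₂ H₂}
    [TopologicalSpace M₁] [ChartedSpace H₁ M₁] [TopologicalSpace M₂] [ChartedSpace H₂ M₂]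
    {f : M₁ → M₂} {g : M₂ → M₁} {x : M₁} {y : M₂} (hxy : f x = y) (hyx : g y = x)
    (hf : MDifferentiableAt I₁ I₂ f x) (hg : MDifferentiableAt I₂ I₁ g y)
    (hgf : ∀ᶠ z in nhds x, g (f z) = z) (hfg : ∀ᶠ z in nhds y, f (g z) = z) :
    (mfderiv I₁ I₂ f x).IsInvertible ∧ (∀ v, mfderiv I₂ I₁ g y (mfderiv I₁ I₂ f x v) = v) ∧
      ∀ v, mfderiv I₁ I₂ f x (mfderiv I₂ I₁ g y v) = v := by
  subst hxy
  have e1 : (mfderiv I₂ I₁ g (f x)).comp (mfderiv I₁ I₂ f x) =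
      ContinuousLinearMap.id ℝ (TangentSpace I₁ x) := by
    rw [← mfderiv_comp x hg hf, ← mfderiv_id]
    exact Filter.EventuallyEq.mfderiv_eq hgf
  have hf' : MDifferentiableAt I₁ I₂ f (g (f x)) := by rw [hyx]; exact hf
  have e2 : (mfderiv I₁ I₂ f (g (f x))).comp (mfderiv I₂ I₁ g (f x)) =
      ContinuousLinearMap.id ℝ (TangentSpace I₂ (f x)) := by
    rw [← mfderiv_comp (f x) hf' hg, ← mfderiv_id]
    exact Filter.EventuallyEq.mfderiv_eq hfg
  have h1 : ∀ v, mfderiv I₂ I₁ g (f x) (mfderiv I₁ I₂ f x v) = v := fun v =>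
    congrArg (fun L => L v) e1
  have h2 : ∀ v, mfderiv I₁ I₂ f x (mfderiv I₂ I₁ g (f x) v) = v := by
    intro v
    -- The points `g (f x)` and `x` are only propositionally equal, so the two derivatives are
    -- compared as maps between the model spaces.
    have key : ∀ x', g (f x) = x' → ∀ v : G₁, (mfderiv I₁ I₂ f x' : G₁ → G₂) v =
        (mfderiv I₁ I₂ f (g (f x)) : G₁ → G₂) v := by
      rintro _ rfl v
      rfl
    exact (key x hyx _).trans (congrArg (fun L => L v) e2)
  exact ⟨⟨ContinuousLinearEquiv.equivOfInverse (M₁ := TangentSpace I₁ x)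
    (M₂ := TangentSpace I₂ (f x)) _ _ h1 h2, rfl⟩, h1, h2⟩

theorem mlieBracket_vectorSpace (V W : G → G) (q : G) :
    mlieBracket 𝓘(ℝ, G) V W q = lieBracket ℝ V W q :=
  (congrFun (mlieBracketWithin_eq_lieBracketWithin (V := V) (W := W) (s := Set.univ)) q).trans
    (congrFun (lieBracketWithin_univ (V := V) (W := W)) q)

/-- The vector field `V`, carried to `M` by the local inverse `Ψ` of a parametrization. -/
def pushField (I : ModelWithCorners ℝ G H) (Ψ : M → G) (V : G → G) : ∀ p : M, TangentSpace I p :=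
  mpullback I 𝓘(ℝ, G) Ψ V

/-- The vector field `A` on `M`, read in the parametrization `Φ`. -/
def pullField (I : ModelWithCorners ℝ G H) (Φ : G → M) (A : ∀ p : M, TangentSpace I p) : G → G :=
  mpullback 𝓘(ℝ, G) I Φ A

/-- Two open sets `Ω` and `s` which are exchanged by mutually inverse smooth maps. -/
structure IsDiffeoOn (I : ModelWithCorners ℝ G H) (Φ : G → M) (Ψ : M → G) (Ω : Set G) (s : Set M) :
    Prop where
  isOpen_source : IsOpen Ω
  isOpen_target : IsOpen s
  mapsTo : Set.MapsTo Φ Ω s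
  mapsTo_inv : Set.MapsTo Ψ s Ω
  left_inv : ∀ q ∈ Ω, Ψ (Φ q) = q
  right_inv : ∀ p ∈ s, Φ (Ψ p) = p
  smooth : ContMDiffOn 𝓘(ℝ, G) I ∞ Φ Ω
  smooth_inv : ContMDiffOn I 𝓘(ℝ, G) ∞ Ψ s

namespace IsDiffeoOn

variable {Φ : G → M} {Ψ : M → G} {Ω : Set G} {s : Set M}

section

variable (h : IsDiffeoOn I Φ Ψ Ω s) {q : G} (hq : q ∈ Ω)
include h hq

theorem isInvertible_mfderiv :
    (mfderiv 𝓘(ℝ, G) I Φ q).IsInvertible ∧ (mfderiv I 𝓘(ℝ, G) Ψ (Φ q)).IsInvertible ∧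
    (∀ v : G, (mfderiv I 𝓘(ℝ, G) Ψ (Φ q) (mfderiv 𝓘(ℝ, G) I Φ q v) : G) = v) ∧
      ∀ v, mfderiv 𝓘(ℝ, G) I Φ q (mfderiv I 𝓘(ℝ, G) Ψ (Φ q) v : G) = v := by
  have hps := h.mapsTo hq
  have hpq := h.left_inv q hq
  have dΦ : MDifferentiableAt 𝓘(ℝ, G) I Φ q :=
    (h.smooth.contMDiffAt (h.isOpen_source.mem_nhds hq)).mdifferentiableAt (by simp)
  have dΨ : MDifferentiableAt I 𝓘(ℝ, G) Ψ (Φ q) :=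
    (h.smooth_inv.contMDiffAt (h.isOpen_target.mem_nhds hps)).mdifferentiableAt (by simp)
  have l1 : ∀ᶠ z in nhds q, Ψ (Φ z) = z := by
    filter_upwards [h.isOpen_source.mem_nhds hq] with z hz using h.left_inv z hz
  have l2 : ∀ᶠ z in nhds (Φ q), Φ (Ψ z) = z := by
    filter_upwards [h.isOpen_target.mem_nhds hps] with z hz using h.right_inv z hz
  obtain ⟨a, b, c⟩ := isInvertible_mfderiv_of_local_inverse rfl hpq dΦ dΨ l1 l2
  obtain ⟨a', -, -⟩ := isInvertible_mfderiv_of_local_inverse hpq rfl dΨ dΦ l2 l1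
  exact ⟨a, a', b, c⟩

theorem mfderiv_inv_mfderiv (v : G) :
    (mfderiv I 𝓘(ℝ, G) Ψ (Φ q) (mfderiv 𝓘(ℝ, G) I Φ q v) : G) = v :=
  (h.isInvertible_mfderiv hq).2.2.1 v

theorem mfderiv_mfderiv_inv (v : TangentSpace I (Φ q)) :
    mfderiv 𝓘(ℝ, G) I Φ q (mfderiv I 𝓘(ℝ, G) Ψ (Φ q) v : G) = v :=
  (h.isInvertible_mfderiv hq).2.2.2 v

theorem injective_mfderiv : Function.Injective (fun v : G => mfderiv 𝓘(ℝ, G) I Φ q v) :=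
  Function.LeftInverse.injective (h.mfderiv_inv_mfderiv hq)

theorem injective_mfderiv_inv :
    Function.Injective (fun v => (mfderiv I 𝓘(ℝ, G) Ψ (Φ q) v : G)) :=
  Function.LeftInverse.injective (h.mfderiv_mfderiv_inv hq)

theorem pushField_apply (V : G → G) :
    pushField I Ψ V (Φ q) = mfderiv 𝓘(ℝ, G) I Φ q (V q) := by
  apply h.injective_mfderiv_inv hq
  refine Eq.trans ?_ (h.mfderiv_inv_mfderiv hq _).symm
  refine (ContinuousLinearMap.IsInvertible.self_apply_inverse
    (h.isInvertible_mfderiv hq).2.1 _).trans ?_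
  exact congrArg V (h.left_inv q hq)

theorem pullField_apply (A : ∀ p : M, TangentSpace I p) :
    pullField I Φ A q = mfderiv I 𝓘(ℝ, G) Ψ (Φ q) (A (Φ q)) := by
  apply h.injective_mfderiv hq
  refine Eq.trans ?_ (h.mfderiv_mfderiv_inv hq _).symm
  exact ContinuousLinearMap.IsInvertible.self_apply_inverse (h.isInvertible_mfderiv hq).1 _

theorem differentiableAt_pullField {A : ∀ p : M, TangentSpace I p}
    (hA : ContMDiffOn I I.tangent ∞ (fun p => (⟨p, A p⟩ : TangentBundle I M)) s) :
    DifferentiableAt ℝ (pullField I Φ A) q := by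
  have : IsManifold I 1 M := IsManifold.of_le (n := ∞) (by simp)
  have h1 := (hA.contMDiffAt (h.isOpen_target.mem_nhds (h.mapsTo hq)))
  have h2 := ContMDiffWithinAt.mpullback_vectorField_preimage (I := 𝓘(ℝ, G)) (I' := I)
    (t := Set.univ) (n := ∞) (m := ∞)
    h1.contMDiffWithinAt (h.smooth.contMDiffAt (h.isOpen_source.mem_nhds hq))
    (h.isInvertible_mfderiv hq).1 (by simp)
  rw [Set.preimage_univ, contMDiffWithinAt_univ] at h2
  have h3 : ContDiffAt ℝ ∞ (pullField I Φ A) q :=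
    contMDiffAt_vectorSpace_iff_contDiffAt.1 h2
  exact h3.differentiableAt (by simp)

theorem mlieBracket_pushField {V W : G → G} (hV : ContDiffOn ℝ ∞ V Ω) (hW : ContDiffOn ℝ ∞ W Ω) :
    mlieBracket I (pushField I Ψ V) (pushField I Ψ W) (Φ q)
      = mfderiv 𝓘(ℝ, G) I Φ q (lieBracket (E := G) ℝ V W q) := by
  have md : ∀ {V : G → G}, ContDiffOn ℝ ∞ V Ω → MDifferentiableAt 𝓘(ℝ, G) 𝓘(ℝ, G).tangent
      (fun x => (⟨x, V x⟩ : TangentBundle 𝓘(ℝ, G) G)) (Ψ (Φ q)) := by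
    intro V hV
    rw [h.left_inv q hq]
    exact (contMDiffAt_vectorSpace_iff_contDiffAt.2
      (hV.contDiffAt (h.isOpen_source.mem_nhds hq))).mdifferentiableAt (by simp)
  have : IsManifold I (minSmoothness ℝ 3) M :=
    IsManifold.of_le (n := ∞) (by simpa using ENat.LEInfty.out)
  refine (mpullback_mlieBracket (n := ∞) (md hV) (md hW)
    (h.smooth_inv.contMDiffAt (h.isOpen_target.mem_nhds (h.mapsTo hq)))
    (by simpa using ENat.LEInfty.out)).symm.trans ?_
  rw [← h.pushField_apply hq]
  refine congrFun (congrArg (mpullback I 𝓘(ℝ, G) Ψ) ?_) (Φ q)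
  exact funext (mlieBracket_vectorSpace V W)

theorem mfderiv_inv_mlieBracket {A B : ∀ p : M, TangentSpace I p}
    (hA : ContMDiffOn I I.tangent ∞ (fun p => (⟨p, A p⟩ : TangentBundle I M)) s)
    (hB : ContMDiffOn I I.tangent ∞ (fun p => (⟨p, B p⟩ : TangentBundle I M)) s) :
    (mfderiv I 𝓘(ℝ, G) Ψ (Φ q) (mlieBracket I A B (Φ q)) : G) =
      lieBracket ℝ (pullField I Φ A) (pullField I Φ B) q := by
  have : IsManifold I (minSmoothness ℝ 3) M :=
    IsManifold.of_le (n := ∞) (by simpa using ENat.LEInfty.out)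
  rw [← h.pullField_apply hq]
  refine (mpullback_mlieBracket (n := ∞)
    ((hA.contMDiffAt (h.isOpen_target.mem_nhds (h.mapsTo hq))).mdifferentiableAt (by simp))
    ((hB.contMDiffAt (h.isOpen_target.mem_nhds (h.mapsTo hq))).mdifferentiableAt (by simp))
    (h.smooth.contMDiffAt (h.isOpen_source.mem_nhds hq)) (by simpa using ENat.LEInfty.out)).trans ?_
  exact mlieBracket_vectorSpace _ _ q

end

theorem contMDiffOn_pushField (h : IsDiffeoOn I Φ Ψ Ω s) {V : G → G} (hV : ContDiffOn ℝ ∞ V Ω) :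
    ContMDiffOn I I.tangent ∞ (fun p => (⟨p, pushField I Ψ V p⟩ : TangentBundle I M)) s := by
  intro p hp
  have hq := h.mapsTo_inv hp
  have : IsManifold I 1 M := IsManifold.of_le (n := ∞) (by simp)
  have hV' : ContMDiffAt 𝓘(ℝ, G) 𝓘(ℝ, G).tangent ∞
      (fun x => (⟨x, V x⟩ : TangentBundle 𝓘(ℝ, G) G)) (Ψ p) := by
    have := (hV.contDiffAt (h.isOpen_source.mem_nhds hq))
    exact contMDiffAt_vectorSpace_iff_contDiffAt.2 this
  have inv : (mfderiv I 𝓘(ℝ, G) Ψ p).IsInvertible := by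
    have := (h.isInvertible_mfderiv hq).2.1
    rwa [h.right_inv p hp] at this
  have := ContMDiffWithinAt.mpullback_vectorField_preimage (I := I) (t := Set.univ) (f := Ψ)
    (n := ∞) (m := ∞)
    hV'.contMDiffWithinAt (h.smooth_inv.contMDiffAt (h.isOpen_target.mem_nhds hp))
    inv (by simp)
  exact this.mono (Set.subset_univ _)

/-- Integrability, read in a parametrization, is the vanishing of the Nijenhuis tensor. -/
theorem isIntegrableOn_iff_nijenhuis [IsManifold I 1 M] (h : IsDiffeoOn I Φ Ψ Ω s)
    {J : ∀ p : M, TangentSpace I p →L[ℝ] TangentSpace I p}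
    {Jc : G → G →L[ℝ] G} (hJc : ContDiffOn ℝ ∞ Jc Ω) (hsq : ∀ q ∈ Ω, ∀ v, Jc q (Jc q v) = -v)
    (hJ : ∀ q ∈ Ω, ∀ v : G, J (Φ q) (mfderiv 𝓘(ℝ, G) I Φ q v) = mfderiv 𝓘(ℝ, G) I Φ q (Jc q v)) :
    IsIntegrableOn J s ↔ ∀ q ∈ Ω, ∀ X Y : G, nijenhuis Jc q X Y = 0 := by
  have hsurj : ∀ p ∈ s, ∃ q ∈ Ω, Φ q = p := fun p hp => ⟨Ψ p, h.mapsTo_inv hp, h.right_inv p hp⟩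
  have hdiff : ∀ q ∈ Ω, DifferentiableAt ℝ Jc q := fun q hq =>
    (hJc.contDiffAt (h.isOpen_source.mem_nhds hq)).differentiableAt (by simp)
  constructor
  · intro hint q hq X Y
    have hsm : ∀ X : G, ContDiffOn ℝ ∞ (fun x => Jc x X) Ω := fun X => hJc.clm_apply contDiffOn_const
    -- Test sections X + √-1 JX with X constant in the coordinates: these take every value X at q,
    -- which suffices for a tensor.
    let F : G → CVectorField I M := fun X =>
      ⟨pushField I Ψ (fun _ => X), pushField I Ψ (fun x => Jc x X)⟩
    have hF : ∀ X, (F X).SmoothOn s := fun X =>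
      ⟨h.contMDiffOn_pushField contDiffOn_const, h.contMDiffOn_pushField (hsm X)⟩
    have hF' : ∀ X, (F X).IsType01On J s := by
      intro X p hp
      obtain ⟨q, hq, rfl⟩ := hsurj p hp
      refine ⟨_, rfl, ?_⟩
      change pushField I Ψ (fun x => Jc x X) (Φ q) = J (Φ q) (pushField I Ψ (fun _ => X) (Φ q))
      rw [h.pushField_apply hq, h.pushField_apply hq]
      exact (hJ _ hq X).symm
    obtain ⟨Z, hZ1, hZ2⟩ := hint (F X) (F Y) (hF X) (hF Y) (hF' X) (hF' Y) (Φ q) (h.mapsTo hq)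
    rw [← hZ1] at hZ2
    simp only [CVectorField.bracket, F] at hZ2
    rw [h.mlieBracket_pushField hq contDiffOn_const (hsm Y),
      h.mlieBracket_pushField hq (hsm X) contDiffOn_const,
      h.mlieBracket_pushField hq contDiffOn_const contDiffOn_const,
      h.mlieBracket_pushField hq (hsm X) (hsm Y)] at hZ2
    have h3 := h.injective_mfderiv hq <| (map_add (mfderiv 𝓘(ℝ, G) I Φ q) _ _).trans <|
      hZ2.trans <| (congrArg (J (Φ q)) (map_sub (mfderiv 𝓘(ℝ, G) I Φ q) _ _).symm).trans (hJ q hq _)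
    have h4 := lieBracket_endo_eq_nijenhuis (V := fun _ => X) (W := fun _ => Y)
      (hdiff q hq) (hsq q hq) (differentiableAt_const _) (differentiableAt_const _)
      (Filter.EventuallyEq.refl _ _) (Filter.EventuallyEq.refl _ _)
    exact h4.symm.trans (sub_eq_zero.2 h3)
  · intro hN A B hA hB hA' hB' p hp
    obtain ⟨q, hq, rfl⟩ := hsurj p hp
    refine ⟨_, rfl, ?_⟩
    -- The type condition holds only over `s`, which gives an identity of germs at q; brackets see
    -- no more than that.
    have ev : ∀ {A : CVectorField I M}, A.IsType01On J s →
        pullField I Φ A.im =ᶠ[nhds q] fun x => Jc x (pullField I Φ A.re x) := by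
      intro A hA
      filter_upwards [h.isOpen_source.mem_nhds hq] with x hx
      obtain ⟨Z, hZ1, hZ2⟩ := hA _ (h.mapsTo hx)
      apply h.injective_mfderiv hx
      refine Eq.trans ?_ (hJ x hx _)
      rw [h.pullField_apply hx, h.pullField_apply hx, hZ2, hZ1]
      refine (h.mfderiv_mfderiv_inv hx _).trans (congrArg _ (h.mfderiv_mfderiv_inv hx _).symm)
    have h4 := sub_eq_zero.1 <| (lieBracket_endo_eq_nijenhuis (hdiff q hq) (hsq _ hq)
      (h.differentiableAt_pullField hq hA.1) (h.differentiableAt_pullField hq hB.1)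
      (ev hA') (ev hB')).trans (hN _ hq _ _)
    apply h.injective_mfderiv_inv hq
    have hJ' : ∀ v : TangentSpace I (Φ q), (mfderiv I 𝓘(ℝ, G) Ψ (Φ q) (J (Φ q) v) : G) =
        Jc q (mfderiv I 𝓘(ℝ, G) Ψ (Φ q) v : G) := by
      intro v
      apply h.injective_mfderiv hq
      refine (h.mfderiv_mfderiv_inv hq _).trans (Eq.trans ?_ (hJ q hq _))
      exact congrArg _ (h.mfderiv_mfderiv_inv hq _).symm
    refine Eq.trans ?_ (h4.trans ?_)
    · rw [← h.mfderiv_inv_mlieBracket hq hA.1 hB.2, ← h.mfderiv_inv_mlieBracket hq hA.2 hB.1]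
      exact map_add (mfderiv I 𝓘(ℝ, G) Ψ (Φ q)) _ _
    · refine Eq.trans ?_ (hJ' _).symm
      rw [← h.mfderiv_inv_mlieBracket hq hA.1 hB.1, ← h.mfderiv_inv_mlieBracket hq hA.2 hB.2]
      exact congrArg (Jc q) (map_sub (mfderiv I 𝓘(ℝ, G) Ψ (Φ q)) _ _).symm

end IsDiffeoOn

end Transfer

/-! ### Gauss formula and curvature of a conformally parametrized sphere. -/

section Gauss

open Module

variable {E W : Type*} [NormedAddCommGroup E] [InnerProductSpace ℝ E] [FiniteDimensional ℝ E]
  [NormedAddCommGroup W] [InnerProductSpace ℝ W] [FiniteDimensional ℝ W]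

/-- The Christoffel symbols `Γ(u, v)` of a conformally flat metric `l² ⟨·,·⟩`,
where `m` is the gradient of `log l`. -/
def conformalGamma (m u v : E) : E := inner ℝ m v • u + inner ℝ m u • v - inner ℝ u v • m

omit [FiniteDimensional ℝ E] in
theorem conformalGamma_comm (m u v : E) : conformalGamma m u v = conformalGamma m v u := by
  simp only [conformalGamma, real_inner_comm u v]
  abel

/-- The gradient of `log l`. -/
def logGrad (l : E → ℝ) (x : E) : E :=
  (l x)⁻¹ • (InnerProductSpace.toDual ℝ E).symm (fderiv ℝ l x)

theorem inner_logGrad (l : E → ℝ) (x u : E) : inner ℝ (logGrad l x) u = fderiv ℝ l x u / l x := by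
  rw [logGrad, real_inner_smul_left, InnerProductSpace.toDual_symm_apply]
  ring

/-- `F` parametrizes a piece of the unit sphere of `W`, conformally with factor `l`. -/
structure IsConformalSphereMap (F : E → W) (l : E → ℝ) (T : Set E) : Prop where
  isOpen : IsOpen T
  smooth : ContDiffOn ℝ ∞ F T
  inner_self : ∀ x ∈ T, inner ℝ (F x) (F x) = 1
  pos : ∀ x ∈ T, 0 < l x
  inner_fderiv : ∀ x ∈ T, ∀ u v, inner ℝ (fderiv ℝ F x u) (fderiv ℝ F x v) = l x ^ 2 * inner ℝ u v

namespace IsConformalSphereMap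

variable {F : E → W} {l : E → ℝ} {T : Set E} (h : IsConformalSphereMap F l T)
include h

theorem contDiffAt {x : E} (hx : x ∈ T) : ContDiffAt ℝ ∞ F x :=
  h.smooth.contDiffAt (h.isOpen.mem_nhds hx)

theorem contDiffOn_fderiv : ContDiffOn ℝ ∞ (fderiv ℝ F) T :=
  h.smooth.fderiv_of_isOpen h.isOpen (by simp)

theorem contDiffOn_fderiv_fderiv : ContDiffOn ℝ ∞ (fderiv ℝ (fderiv ℝ F)) T :=
  h.contDiffOn_fderiv.fderiv_of_isOpen h.isOpen (by simp)

theorem hasFDerivAt {x : E} (hx : x ∈ T) : HasFDerivAt F (fderiv ℝ F x) x :=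
  ((h.contDiffAt hx).differentiableAt (by simp)).hasFDerivAt

theorem hasFDerivAt_fderiv {x : E} (hx : x ∈ T) :
    HasFDerivAt (fderiv ℝ F) (fderiv ℝ (fderiv ℝ F) x) x :=
  ((h.contDiffOn_fderiv.contDiffAt (h.isOpen.mem_nhds hx)).differentiableAt (by simp)).hasFDerivAt

theorem hasFDerivAt_fderiv_fderiv {x : E} (hx : x ∈ T) :
    HasFDerivAt (fderiv ℝ (fderiv ℝ F)) (fderiv ℝ (fderiv ℝ (fderiv ℝ F)) x) x :=
  ((h.contDiffOn_fderiv_fderiv.contDiffAt (h.isOpen.mem_nhds hx)).differentiableAt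
    (by simp)).hasFDerivAt

theorem fderiv_fderiv_comm {x : E} (hx : x ∈ T) (u v : E) :
    fderiv ℝ (fderiv ℝ F) x u v = fderiv ℝ (fderiv ℝ F) x v u :=
  (h.contDiffAt hx).isSymmSndFDerivAt (by simpa using ENat.LEInfty.out) u v

theorem fderiv_fderiv_fderiv_comm {x : E} (hx : x ∈ T) (u v w : E) :
    fderiv ℝ (fderiv ℝ (fderiv ℝ F)) x u v w = fderiv ℝ (fderiv ℝ (fderiv ℝ F)) x v u w :=
  congrArg (fun L => L w) <| (h.contDiffOn_fderiv.contDiffAt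
    (h.isOpen.mem_nhds hx)).isSymmSndFDerivAt (by simpa using ENat.LEInfty.out) u v

theorem inner_fderiv_self {x : E} (hx : x ∈ T) (u : E) : inner ℝ (fderiv ℝ F x u) (F x) = 0 := by
  have h1 : HasFDerivAt (fun x => inner ℝ (F x) (F x)) (0 : E →L[ℝ] ℝ) x :=
    (hasFDerivAt_const (1 : ℝ) x).congr_of_eventuallyEq
      (Filter.eventually_of_mem (h.isOpen.mem_nhds hx) h.inner_self)
  have h2 := (h.hasFDerivAt hx).inner ℝ (h.hasFDerivAt hx)
  have := congrArg (fun L => L u) (h2.unique h1)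
  simp [real_inner_comm (fderiv ℝ F x u)] at this
  linarith [real_inner_comm (F x) (fderiv ℝ F x u)]

/-- Smoothness of the factor is not assumed: for a unit vector u it equals the norm of DF(u), which
is smooth because it never vanishes. -/
theorem contDiffOn_factor [Nontrivial E] : ContDiffOn ℝ ∞ l T := by
  obtain ⟨u, hu⟩ := exists_norm_eq E (zero_le_one (α := ℝ))
  have h1 : ContDiffOn ℝ ∞ (fun x => inner ℝ (fderiv ℝ F x u) (fderiv ℝ F x u)) T :=
    (h.contDiffOn_fderiv.clm_apply contDiffOn_const).inner ℝ
      (h.contDiffOn_fderiv.clm_apply contDiffOn_const)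
  have h2 : ∀ x ∈ T, inner ℝ (fderiv ℝ F x u) (fderiv ℝ F x u) = l x ^ 2 := by
    intro x hx
    rw [h.inner_fderiv x hx, real_inner_self_eq_norm_sq, hu]
    ring
  refine (h1.sqrt fun x hx => ?_).congr fun x hx => ?_
  · rw [h2 x hx]
    exact (pow_pos (h.pos x hx) 2).ne'
  · rw [h2 x hx, Real.sqrt_sq (h.pos x hx).le]

theorem hasFDerivAt_factor [Nontrivial E] {x : E} (hx : x ∈ T) :
    HasFDerivAt l (fderiv ℝ l x) x :=
  ((h.contDiffOn_factor.contDiffAt (h.isOpen.mem_nhds hx)).differentiableAt (by simp)).hasFDerivAt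

theorem contDiffOn_logGrad [Nontrivial E] : ContDiffOn ℝ ∞ (logGrad l) T := by
  refine (h.contDiffOn_factor.inv fun x hx => (h.pos x hx).ne').smul ?_
  exact ((InnerProductSpace.toDual ℝ E).symm.toContinuousLinearEquiv.contDiff (n := ∞)
    (𝕜 := ℝ)).comp_contDiffOn (h.contDiffOn_factor.fderiv_of_isOpen h.isOpen (by simp))

theorem hasFDerivAt_logGrad [Nontrivial E] {x : E} (hx : x ∈ T) :
    HasFDerivAt (logGrad l) (fderiv ℝ (logGrad l) x) x :=
  ((h.contDiffOn_logGrad.contDiffAt (h.isOpen.mem_nhds hx)).differentiableAt (by simp)).hasFDerivAt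

/-- The Koszul argument: differentiate the conformality relation in three directions, then add two
of the identities and subtract the third, using the symmetry of D²F. -/
theorem inner_fderiv_fderiv [Nontrivial E] {x : E} (hx : x ∈ T) (u v w : E) :
    inner ℝ (fderiv ℝ (fderiv ℝ F) x u v) (fderiv ℝ F x w)
      = l x ^ 2 * inner ℝ (conformalGamma (logGrad l x) u v) w := by
  have key : ∀ u v w, inner ℝ (fderiv ℝ (fderiv ℝ F) x u v) (fderiv ℝ F x w)
      + inner ℝ (fderiv ℝ (fderiv ℝ F) x u w) (fderiv ℝ F x v)
      = 2 * l x ^ 2 * inner ℝ (logGrad l x) u * inner ℝ v w := by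
    intro u v w
    have d := h.hasFDerivAt_fderiv hx
    have h2 := (d.clm_apply (hasFDerivAt_const v x)).inner ℝ (d.clm_apply (hasFDerivAt_const w x))
    have h1 : HasFDerivAt (fun x => inner ℝ (fderiv ℝ F x v) (fderiv ℝ F x w)) _ x :=
      (((h.hasFDerivAt_factor hx).pow 2).mul_const (inner ℝ v w)).congr_of_eventuallyEq
      (Filter.eventually_of_mem (h.isOpen.mem_nhds hx) fun y hy => h.inner_fderiv y hy v w)
    have := congrArg (fun L => L u) (h2.unique h1)
    simp at this
    rw [inner_logGrad, real_inner_comm (fderiv ℝ F x v), add_comm, this]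
    field_simp [(h.pos x hx).ne']
  have a := key u v w
  have b := key v u w
  have c := key w u v
  rw [h.fderiv_fderiv_comm hx v u] at b
  rw [h.fderiv_fderiv_comm hx w u, h.fderiv_fderiv_comm hx w v] at c
  simp only [conformalGamma, inner_sub_left, inner_add_left, real_inner_smul_left]
  linarith

theorem injective_fderiv {x : E} (hx : x ∈ T) : Function.Injective (fderiv ℝ F x) := by
  rw [injective_iff_map_eq_zero]
  intro u hu
  have := h.inner_fderiv x hx u u
  rw [hu, inner_zero_left] at this
  rcases mul_eq_zero.1 this.symm with h1 | h1
  · exact absurd h1 (pow_pos (h.pos x hx) 2).ne'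
  · exact inner_self_eq_zero.1 h1

/-- The range of DF has codimension one, and F spans its orthogonal complement. -/
theorem eq_zero_of_inner (hdim : finrank ℝ W = finrank ℝ E + 1) {x : E} (hx : x ∈ T) {z : W}
    (hz : inner ℝ z (F x) = 0) (hz' : ∀ w, inner ℝ z (fderiv ℝ F x w) = 0) : z = 0 := by
  have hinj := h.injective_fderiv hx
  set S : Submodule ℝ W := LinearMap.range (fderiv ℝ F x : E →ₗ[ℝ] W)
  have hS : finrank ℝ S = finrank ℝ E := LinearMap.finrank_range_of_inj hinj
  have hS' : finrank ℝ Sᗮ = 1 := by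
    have := S.finrank_add_finrank_orthogonal
    omega
  have mem : ∀ z : W, (∀ w, inner ℝ z (fderiv ℝ F x w) = 0) → z ∈ Sᗮ := by
    intro z hz
    rw [Submodule.mem_orthogonal']
    rintro _ ⟨w, rfl⟩
    exact hz w
  have hF : F x ∈ Sᗮ := mem _ fun w => by rw [real_inner_comm]; exact h.inner_fderiv_self hx w
  have hF0 : (⟨F x, hF⟩ : Sᗮ) ≠ 0 := by
    intro h0
    have := h.inner_self x hx
    rw [show F x = 0 from congrArg Subtype.val h0] at this
    simp at this
  obtain ⟨c, hc⟩ := (finrank_eq_one_iff_of_nonzero' _ hF0).1 hS' ⟨z, mem z hz'⟩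
  have hc' : c • F x = z := congrArg Subtype.val hc
  rw [← hc', real_inner_smul_left, h.inner_self x hx, mul_one] at hz
  rw [← hc', hz, zero_smul]

/-- The Gauss formula. -/
theorem gauss_formula [Nontrivial E] (hdim : finrank ℝ W = finrank ℝ E + 1) {x : E} (hx : x ∈ T)
    (u v : E) : fderiv ℝ (fderiv ℝ F) x u v
      = fderiv ℝ F x (conformalGamma (logGrad l x) u v) - (l x ^ 2 * inner ℝ u v) • F x := by
  rw [← sub_eq_zero]
  apply h.eq_zero_of_inner hdim hx
  -- The normal component comes from differentiating ⟨DF(v), F⟩ = 0; the tangential one below is the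
  -- Koszul identity.
  · have h1 : HasFDerivAt (fun x => inner ℝ (fderiv ℝ F x v) (F x)) (0 : E →L[ℝ] ℝ) x :=
      (hasFDerivAt_const (0 : ℝ) x).congr_of_eventuallyEq
        (Filter.eventually_of_mem (h.isOpen.mem_nhds hx) fun y hy => h.inner_fderiv_self hy v)
    have h2 := ((h.hasFDerivAt_fderiv hx).clm_apply (hasFDerivAt_const v x)).inner ℝ
      (h.hasFDerivAt hx)
    have := congrArg (fun L => L u) (h2.unique h1)
    simp [h.inner_fderiv x hx] at this
    simp only [inner_sub_left, real_inner_smul_left, h.inner_self x hx, h.inner_fderiv_self hx,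
      real_inner_comm v u] at this ⊢
    linarith
  · intro w
    simp only [inner_sub_left, real_inner_smul_left, h.inner_fderiv_fderiv hx,
      h.inner_fderiv x hx, real_inner_comm (fderiv ℝ F x w) (F x), h.inner_fderiv_self hx]
    ring

/-- Γ is linear in the gradient of log l, so differentiating it along w replaces that gradient by
its derivative along w. -/
theorem hasFDerivAt_conformalGamma [Nontrivial E] {x : E} (hx : x ∈ T) (u v : E) :
    HasFDerivAt (fun x => conformalGamma (logGrad l x) u v)
      (((innerSL ℝ v).comp (fderiv ℝ (logGrad l) x)).smulRight u
        + ((innerSL ℝ u).comp (fderiv ℝ (logGrad l) x)).smulRight v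
        - (inner ℝ u v : ℝ) • fderiv ℝ (logGrad l) x) x := by
  have d := h.hasFDerivAt_logGrad hx
  have e : ∀ v : E, HasFDerivAt (fun x => inner ℝ (logGrad l x) v)
      ((innerSL ℝ v).comp (fderiv ℝ (logGrad l) x)) x := by
    intro v
    have := ((innerSL ℝ v).hasFDerivAt (x := logGrad l x)).comp x d
    refine this.congr_of_eventuallyEq (Filter.Eventually.of_forall fun y => ?_)
    simp [real_inner_comm]
  exact (((e v).smul_const u).add ((e u).smul_const v)).sub (d.const_smul _)

/-- The Gauss equation: the metric has constant curvature one. -/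
theorem gauss_equation [Nontrivial E] (hdim : finrank ℝ W = finrank ℝ E + 1) {x : E} (hx : x ∈ T)
    (w u v : E) :
    (conformalGamma (logGrad l x) w (conformalGamma (logGrad l x) u v)
        + conformalGamma (fderiv ℝ (logGrad l) x w) u v)
      - (conformalGamma (logGrad l x) u (conformalGamma (logGrad l x) w v)
        + conformalGamma (fderiv ℝ (logGrad l) x u) w v)
      = (l x ^ 2 * inner ℝ u v) • w - (l x ^ 2 * inner ℝ w v) • u := by
  have hinj := h.injective_fderiv hx
  -- Differentiate the Gauss formula and substitute it once more. Only the tangential part matters,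
  -- so the normal coefficient is left unnamed.
  have key : ∀ w u v, ∃ c : ℝ, fderiv ℝ (fderiv ℝ (fderiv ℝ F)) x w u v =
      fderiv ℝ F x (conformalGamma (logGrad l x) w (conformalGamma (logGrad l x) u v)
        + conformalGamma (fderiv ℝ (logGrad l) x w) u v - (l x ^ 2 * inner ℝ u v) • w)
        + c • F x := by
    intro w u v
    have h1 : HasFDerivAt (fun x => fderiv ℝ (fderiv ℝ F) x u v) _ x :=
      (((h.hasFDerivAt_fderiv hx).clm_apply (h.hasFDerivAt_conformalGamma hx u v)).sub
        ((((h.hasFDerivAt_factor hx).pow 2).mul_const (inner ℝ u v)).smul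
          (h.hasFDerivAt hx))).congr_of_eventuallyEq
      (Filter.eventually_of_mem (h.isOpen.mem_nhds hx) fun y hy => h.gauss_formula hdim hy u v)
    have h2 := ((h.hasFDerivAt_fderiv_fderiv hx).clm_apply (hasFDerivAt_const u x)).clm_apply
      (hasFDerivAt_const v x)
    have := congrArg (fun L => L w) (h2.unique h1)
    simp [h.gauss_formula hdim hx w] at this
    refine ⟨-(l x ^ 2 * inner ℝ w (conformalGamma (logGrad l x) u v)
      + inner ℝ u v * (2 * l x * fderiv ℝ l x w)), ?_⟩
    rw [this, map_sub, map_add, map_smul,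
      show conformalGamma (fderiv ℝ (logGrad l) x w) u v =
        (inner ℝ v (fderiv ℝ (logGrad l) x w) : ℝ) • u
        + (inner ℝ u (fderiv ℝ (logGrad l) x w) : ℝ) • v
        - (inner ℝ u v : ℝ) • fderiv ℝ (logGrad l) x w by
        simp only [conformalGamma, real_inner_comm (fderiv ℝ (logGrad l) x w)],
      map_sub, map_add, map_smul, map_smul, map_smul]
    module
  obtain ⟨c₁, h₁⟩ := key w u v
  obtain ⟨c₂, h₂⟩ := key u w v
  have h3 := (h₁.symm.trans (h.fderiv_fderiv_fderiv_comm hx w u v)).trans h₂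
  have hc : c₁ = c₂ := by
    have := congrArg (fun z => inner ℝ z (F x)) h3
    simpa only [inner_add_left, real_inner_smul_left, h.inner_fderiv_self hx, h.inner_self x hx,
      zero_add, mul_one] using this
  rw [hc, add_left_inj] at h3
  have h4 := hinj h3
  rw [sub_eq_sub_iff_add_eq_add] at h4 ⊢
  rw [h4]
  abel

end IsConformalSphereMap

end Gauss

/-! ### The isotropic structure in coordinates and its Nijenhuis tensor. -/

section Isotropic

variable {E : Type*} [NormedAddCommGroup E] [InnerProductSpace ℝ E]

theorem conformalGamma_add_left (m u u' v : E) :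
    conformalGamma m (u + u') v = conformalGamma m u v + conformalGamma m u' v := by
  simp only [conformalGamma, inner_add_left, inner_add_right]
  module

theorem conformalGamma_smul_left (m : E) (c : ℝ) (u v : E) :
    conformalGamma m (c • u) v = c • conformalGamma m u v := by
  simp only [conformalGamma, real_inner_smul_left, real_inner_smul_right]
  module

theorem conformalGamma_add_right (m u v v' : E) :
    conformalGamma m u (v + v') = conformalGamma m u v + conformalGamma m u v' := by
  rw [conformalGamma_comm, conformalGamma_add_left, conformalGamma_comm m v,
    conformalGamma_comm m v']

theorem conformalGamma_smul_right (m : E) (c : ℝ) (u v : E) :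
    conformalGamma m u (c • v) = c • conformalGamma m u v := by
  rw [conformalGamma_comm, conformalGamma_smul_left, conformalGamma_comm m v]

theorem conformalGamma_smul_base (m : E) (c : ℝ) (u v : E) :
    conformalGamma (c • m) u v = c • conformalGamma m u v := by
  simp only [conformalGamma, real_inner_smul_left]
  module

/-- The tangent vector at `(x, y)` to the tangent bundle whose horizontal part lifts `h` and whose
vertical part is `k`; `m` is the gradient of the logarithm of the conformal factor at `x`. -/
def liftVector (m y h k : E) : E × E := (h, k - conformalGamma m h y)

/-- The operator `u ↦ Γ(u, y)`. -/
def conformalGammaL (m y : E) : E →L[ℝ] E :=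
  (inner ℝ m y : ℝ) • ContinuousLinearMap.id ℝ E + (innerSL ℝ m).smulRight y
    - (innerSL ℝ y).smulRight m

theorem conformalGammaL_apply (m y u : E) : conformalGammaL m y u = conformalGamma m u y := by
  simp [conformalGammaL, conformalGamma, real_inner_comm u y]

/-- The isotropic almost complex structure in the coordinates `(x, y)`. -/
def isotropicEndo (m : E → E) (a d s : E × E → ℝ) (q : E × E) : E × E →L[ℝ] E × E :=
  let Γ := conformalGammaL (m q.1) q.2
  -- `V` extracts the vertical part k of a vector written as `liftVector m y h k`; the final pair
  -- reassembles the image from its two parts.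
  let V := ContinuousLinearMap.snd ℝ E E + Γ.comp (ContinuousLinearMap.fst ℝ E E)
  let h := s q • ContinuousLinearMap.fst ℝ E E - d q • V
  (h).prod (a q • ContinuousLinearMap.fst ℝ E E - s q • V - Γ.comp h)

variable {m : E → E} {a d s : E × E → ℝ} {q : E × E}

theorem isotropicEndo_apply (p : E × E) : isotropicEndo m a d s q p =
    liftVector (m q.1) q.2
      (s q • p.1 - d q • (p.2 + conformalGamma (m q.1) p.1 q.2))
      (a q • p.1 - s q • (p.2 + conformalGamma (m q.1) p.1 q.2)) := by
  simp only [liftVector, ← conformalGammaL_apply]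
  rfl

theorem isotropicEndo_liftVector (h k : E) :
    isotropicEndo m a d s q (liftVector (m q.1) q.2 h k) =
      liftVector (m q.1) q.2 (s q • h - d q • k) (a q • h - s q • k) := by
  rw [isotropicEndo_apply]
  simp [liftVector]

theorem liftVector_zero (m y k : E) : liftVector m y 0 k = (0, k) := by
  simp [liftVector, conformalGamma]

theorem liftVector_add (m y h k h' k' : E) :
    liftVector m y h k + liftVector m y h' k' = liftVector m y (h + h') (k + k') := by
  simp only [liftVector, conformalGamma_add_left, Prod.mk_add_mk, Prod.mk.injEq, true_and]
  abel

theorem liftVector_smul (m y : E) (c : ℝ) (h k : E) :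
    c • liftVector m y h k = liftVector m y (c • h) (c • k) := by
  simp only [liftVector, conformalGamma_smul_left, Prod.smul_mk, smul_sub]

theorem liftVector_sub (m y h k h' k' : E) :
    liftVector m y h k - liftVector m y h' k' = liftVector m y (h - h') (k - k') := by
  rw [sub_eq_add_neg, ← neg_one_smul ℝ, liftVector_smul, liftVector_add]
  simp only [neg_smul, one_smul, sub_eq_add_neg]

theorem eq_liftVector (m y : E) (p : E × E) :
    p = liftVector m y p.1 (p.2 + conformalGamma m p.1 y) := by
  simp [liftVector]

theorem isotropicEndo_vertical (v : E) :
    isotropicEndo m a d s q (0, v) = (-d q • v, -s q • v + d q • conformalGamma (m q.1) v q.2) := by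
  rw [← liftVector_zero (m q.1) q.2, isotropicEndo_liftVector, liftVector]
  simp only [smul_zero, zero_sub, ← neg_smul, conformalGamma_smul_left]
  ext1
  · rfl
  · simp only
    module

theorem isotropicEndo_isotropicEndo (hdet : a q * d q - s q ^ 2 = 1) (p : E × E) :
    isotropicEndo m a d s q (isotropicEndo m a d s q p) = -p := by
  rw [eq_liftVector (m q.1) q.2 p, isotropicEndo_liftVector, isotropicEndo_liftVector]
  generalize p.2 + conformalGamma (m q.1) p.1 q.2 = k
  generalize p.1 = h
  have ha : a q * d q = 1 + s q ^ 2 := by linarith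
  have e1 : s q • (s q • h - d q • k) - d q • (a q • h - s q • k) = (-1 : ℝ) • h := by
    linear_combination (norm := module) (-ha) • h
  have e2 : a q • (s q • h - d q • k) - s q • (a q • h - s q • k) = (-1 : ℝ) • k := by
    linear_combination (norm := module) (-ha) • k
  rw [e1, e2]
  simp only [liftVector, conformalGamma_smul_left, Prod.neg_mk, Prod.mk.injEq]
  constructor <;> module

theorem contDiffOn_isotropicEndo [FiniteDimensional ℝ E] {Ω : Set (E × E)} {T : Set E}
    (hΩ : Set.MapsTo Prod.fst Ω T) (hm : ContDiffOn ℝ ∞ m T)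
    (ha : ContDiffOn ℝ ∞ a Ω) (hd : ContDiffOn ℝ ∞ d Ω) (hs : ContDiffOn ℝ ∞ s Ω) :
    ContDiffOn ℝ ∞ (isotropicEndo m a d s) Ω := by
  rw [contDiffOn_clm_apply]
  intro p
  simp only [isotropicEndo_apply, liftVector]
  have hm' : ContDiffOn ℝ ∞ (fun q : E × E => m q.1) Ω := hm.comp contDiffOn_fst hΩ
  have hy : ContDiffOn ℝ ∞ (fun q : E × E => q.2) Ω := contDiffOn_snd
  have hΓ : ∀ {f : E × E → E}, ContDiffOn ℝ ∞ f Ω →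
      ContDiffOn ℝ ∞ (fun q => conformalGamma (m q.1) (f q) q.2) Ω := by
    intro f hf
    exact (((hm'.inner ℝ hy).smul hf).add ((hm'.inner ℝ hf).smul hy)).sub
      ((hf.inner ℝ hy).smul hm')
  have hV : ContDiffOn ℝ ∞ (fun q => p.2 + conformalGamma (m q.1) p.1 q.2) Ω :=
    contDiffOn_const.add (hΓ contDiffOn_const)
  have h1 := (hs.smul (contDiffOn_const (c := p.1))).sub (hd.smul hV)
  exact h1.prodMk (((ha.smul (contDiffOn_const (c := p.1))).sub (hs.smul hV)).sub (hΓ h1))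

/-- J(0, v) is explicit in d, s and Γ. In its derivative the terms with ∂d form the lift of -∂d·v,
while Γ is differentiated both through its gradient argument and through y. -/
theorem fderiv_isotropicEndo_vertical
    (hJ : DifferentiableAt ℝ (isotropicEndo m a d s) q) (hm : DifferentiableAt ℝ m q.1)
    (hd : DifferentiableAt ℝ d q) (hs : DifferentiableAt ℝ s q) (X : E × E) (v : E) :
    fderiv ℝ (isotropicEndo m a d s) q X (0, v) =
      liftVector (m q.1) q.2 (-fderiv ℝ d q X • v)
        (-fderiv ℝ s q X • v + d q • (conformalGamma (fderiv ℝ m q.1 X.1) v q.2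
          + conformalGamma (m q.1) v X.2)) := by
  have h1 := hJ.hasFDerivAt.clm_apply (hasFDerivAt_const ((0 : E), v) q)
  have hm' : HasFDerivAt (fun q : E × E => m q.1)
      ((fderiv ℝ m q.1).comp (ContinuousLinearMap.fst ℝ E E)) q :=
    HasFDerivAt.comp q hm.hasFDerivAt hasFDerivAt_fst
  have hv := hasFDerivAt_const (𝕜 := ℝ) v q
  have hy : HasFDerivAt (fun q : E × E => q.2) (ContinuousLinearMap.snd ℝ E E) q := hasFDerivAt_snd
  have hΓ := (((hm'.inner ℝ hy).smul hv).add ((hm'.inner ℝ hv).smul hy)).sub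
      ((hv.inner ℝ hy).smul hm')
  have h2 := (hd.hasFDerivAt.neg.smul hv).prodMk
    ((hs.hasFDerivAt.neg.smul hv).add (hd.hasFDerivAt.smul hΓ))
  have h3 : HasFDerivAt (fun q => isotropicEndo m a d s q (0, v)) _ q :=
    h2.congr_of_eventuallyEq (Filter.Eventually.of_forall fun q => isotropicEndo_vertical v)
  have := congrArg (fun L => L X) (h1.unique h3)
  simp only [ContinuousLinearMap.comp_zero, zero_add, ContinuousLinearMap.flip_apply] at this
  rw [this]
  simp [liftVector]
  simp only [conformalGamma, inner_neg_left, inner_neg_right, real_inner_smul_left,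
    real_inner_smul_right]
  module

/-- The Nijenhuis tensor of the isotropic structure on vertical vectors, when the metric
has constant curvature one. -/
theorem nijenhuis_isotropicEndo_vertical {c : ℝ}
    (hJ : DifferentiableAt ℝ (isotropicEndo m a d s) q) (hm : DifferentiableAt ℝ m q.1)
    (hd : DifferentiableAt ℝ d q) (hs : DifferentiableAt ℝ s q)
    (hcurv : ∀ w u v : E,
      (conformalGamma (m q.1) w (conformalGamma (m q.1) u v)
        + conformalGamma (fderiv ℝ m q.1 w) u v)
      - (conformalGamma (m q.1) u (conformalGamma (m q.1) w v)
        + conformalGamma (fderiv ℝ m q.1 u) w v) = (c * inner ℝ u v) • w - (c * inner ℝ w v) • u)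
    (A B : E → ℝ)
    (hA : A = fun u => -fderiv ℝ d q (0, u) - s q * fderiv ℝ d q (isotropicEndo m a d s q (0, u))
      + d q * fderiv ℝ s q (isotropicEndo m a d s q (0, u)) - d q ^ 3 * c * inner ℝ u q.2)
    (hB : B = fun u => -fderiv ℝ s q (0, u) - a q * fderiv ℝ d q (isotropicEndo m a d s q (0, u))
      + s q * fderiv ℝ s q (isotropicEndo m a d s q (0, u)) - s q * d q ^ 2 * c * inner ℝ u q.2)
    (u v : E) :
    nijenhuis (isotropicEndo m a d s) q (0, u) (0, v) =
      liftVector (m q.1) q.2 (A u • v - A v • u) (B u • v - B v • u) := by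
  have hc := hcurv v u q.2
  simp only [nijenhuis, nijenhuisHalf, fderiv_isotropicEndo_vertical hJ hm hd hs,
    isotropicEndo_liftVector, hA, hB]
  set du := fderiv ℝ d q (isotropicEndo m a d s q (0, u))
  set dv := fderiv ℝ d q (isotropicEndo m a d s q (0, v))
  set su := fderiv ℝ s q (isotropicEndo m a d s q (0, u))
  set sv := fderiv ℝ s q (isotropicEndo m a d s q (0, v))
  simp only [isotropicEndo_vertical, conformalGamma_add_right, conformalGamma_smul_right, map_smul,
    conformalGamma_smul_base, map_zero]
  have z : ∀ v, conformalGamma 0 v q.2 = 0 := by simp [conformalGamma]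
  rw [conformalGamma_comm (m q.1) v u, z, z]
  rw [liftVector_add, liftVector_add, liftVector_sub]
  -- The Γ-terms add up to d² times the curvature expression `hc` in the vertical slot. J sends a
  -- vertical k to horizontal part -dk and vertical part -sk, hence the coefficients -d³ and -sd².
  congr 1
  · linear_combination (norm := module) (-d q ^ 3) • hc
  · linear_combination (norm := module) (-s q * d q ^ 2) • hc

end Isotropic

/-! ### From two real equations to one complex equation. -/

section IsotropicEquation

/-- For a second index j ≠ i, the j-th component of L(e_i)e_j - L(e_j)e_i is L(e_i). In dimension
one the left condition would be empty. -/
theorem forall_smul_sub_smul_eq_zero_iff {n : ℕ} (hn : 2 ≤ n)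
    (L : EuclideanSpace ℝ (Fin n) →L[ℝ] ℝ) :
    (∀ u v, L u • v - L v • u = 0) ↔ ∀ i, L (EuclideanSpace.single i 1) = 0 := by
  constructor
  · intro h i
    have : Nontrivial (Fin n) := Fin.nontrivial_iff_two_le.2 hn
    obtain ⟨j, hj⟩ := exists_ne i
    have := congrArg (fun v => v j) (h (EuclideanSpace.single i 1) (EuclideanSpace.single j 1))
    simpa [hj] using this
  · intro h
    have : L = 0 := by
      ext u
      rw [← (EuclideanSpace.basisFun (Fin n) ℝ).sum_repr u]
      simp [h]
    simp [this]

variable {E : Type*} [NormedAddCommGroup E] [InnerProductSpace ℝ E]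
  {m : E → E} {a d s : E × E → ℝ} {q : E × E}

/-- The function `(s + √-1) / d`. -/
def isotropicZ (d s : E × E → ℝ) (q : E × E) : ℂ := ((s q : ℂ) + Complex.I) / (d q : ℂ)

theorem fderiv_isotropicZ (hd : DifferentiableAt ℝ d q) (hs : DifferentiableAt ℝ s q)
    (hd0 : d q ≠ 0) (X : E × E) :
    fderiv ℝ (isotropicZ d s) q X =
      ⟨fderiv ℝ s q X / d q - s q * fderiv ℝ d q X / d q ^ 2, -fderiv ℝ d q X / d q ^ 2⟩ := by
  have h1 := (hasDerivAt_inv hd0).comp_hasFDerivAt q hd.hasFDerivAt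
  have h2 := (Complex.ofRealCLM.hasFDerivAt (x := s q * (d q)⁻¹)).comp q (hs.hasFDerivAt.mul h1)
  have h3 := (Complex.ofRealCLM.hasFDerivAt (x := (d q)⁻¹)).comp q h1
  have h4 : HasFDerivAt (isotropicZ d s) _ q :=
    (h2.add (h3.const_mul Complex.I)).congr_of_eventuallyEq
    (Filter.Eventually.of_forall fun x => by
      simp only [isotropicZ, Pi.add_apply, Function.comp_apply, Complex.ofRealCLM_apply, Pi.mul_apply,
        Complex.ofReal_mul, Complex.ofReal_inv, div_eq_mul_inv]
      ring)
  rw [h4.fderiv]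
  apply Complex.ext
  · simp [-Complex.ofReal_pow]
    field_simp
    ring
  · simp [-Complex.ofReal_pow]
    field_simp

/-- The two real equations expressing that the Nijenhuis tensor vanishes are equivalent to
a single complex equation. -/
theorem isotropic_equations_iff {c : ℝ} (hd : DifferentiableAt ℝ d q)
    (hs : DifferentiableAt ℝ s q) (hdet : a q * d q - s q ^ 2 = 1) (u : E) :
    (-fderiv ℝ d q (0, u) - s q * fderiv ℝ d q (isotropicEndo m a d s q (0, u))
      + d q * fderiv ℝ s q (isotropicEndo m a d s q (0, u)) - d q ^ 3 * c * inner ℝ u q.2 = 0 ∧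
    -fderiv ℝ s q (0, u) - a q * fderiv ℝ d q (isotropicEndo m a d s q (0, u))
      + s q * fderiv ℝ s q (isotropicEndo m a d s q (0, u))
      - s q * d q ^ 2 * c * inner ℝ u q.2 = 0) ↔
    fderiv ℝ (isotropicZ d s) q (liftVector (m q.1) q.2 u 0)
      + isotropicZ d s q * fderiv ℝ (isotropicZ d s) q (0, u) + ((c * inner ℝ u q.2 : ℝ) : ℂ) = 0 := by
  have hd0 : d q ≠ 0 := by
    rintro h
    rw [h] at hdet
    nlinarith [sq_nonneg (s q)]
  -- This is J u^v = -δ u^h - σ u^v, so all derivatives reduce to those along u^h and u^v.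
  have e : isotropicEndo m a d s q (0, u) =
      (-d q) • liftVector (m q.1) q.2 u 0 + (-s q) • ((0 : E), u) := by
    rw [isotropicEndo_vertical]
    apply Prod.ext
    · simp [liftVector]
    · simp only [liftVector, Prod.snd_add, Prod.smul_snd]
      module
  have hz : isotropicZ d s q = ⟨s q / d q, 1 / d q⟩ := by
    apply Complex.ext <;> simp [isotropicZ, Complex.div_re, Complex.div_im, Complex.normSq]
    field_simp
  simp only [e, map_add, map_smul, smul_eq_mul, fderiv_isotropicZ hd hs hd0, hz]
  generalize fderiv ℝ d q (liftVector (m q.1) q.2 u 0) = dh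
  generalize fderiv ℝ s q (liftVector (m q.1) q.2 u 0) = sh
  generalize fderiv ℝ d q (0, u) = dv
  generalize fderiv ℝ s q (0, u) = sv
  generalize hC : c * inner ℝ u q.2 = C
  generalize a q = a at *
  generalize d q = d at *
  generalize s q = s at *
  have hC1 : d ^ 3 * c * inner ℝ u q.2 = d ^ 3 * C := by rw [← hC]; ring
  have hC2 : s * d ^ 2 * c * inner ℝ u q.2 = s * d ^ 2 * C := by rw [← hC]; ring
  rw [hC1, hC2, Complex.ext_iff]
  have ha : a = (1 + s ^ 2) / d := by field_simp; linarith
  -- Both systems are invertible in R₁, R₂: the real pair is (sR₁ - dR₂, aR₁ - sR₂), of determinant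
  -- ad - s² = 1, and the complex equation is triangular with powers of 1/d, up to sign, on the
  -- diagonal.
  set R₁ := d * dh + 2 * s * dv - d * sv with hR₁
  set R₂ := d * sh + a * dv + d ^ 2 * C with hR₂
  have im : ((⟨sh / d - s * dh / d ^ 2, -dh / d ^ 2⟩ : ℂ) + ⟨s / d, 1 / d⟩ *
      ⟨sv / d - s * dv / d ^ 2, -dv / d ^ 2⟩ + (C : ℂ)).im = -R₁ / d ^ 3 := by
    simp [hR₁]
    field_simp
    ring
  have re : ((⟨sh / d - s * dh / d ^ 2, -dh / d ^ 2⟩ : ℂ) + ⟨s / d, 1 / d⟩ *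
      ⟨sv / d - s * dv / d ^ 2, -dv / d ^ 2⟩ + (C : ℂ)).re = R₂ / d ^ 2 - s * R₁ / d ^ 3 := by
    simp [hR₁, hR₂, ha]
    field_simp
    ring
  rw [im, re]
  have e1 : -dv - s * (-d * dh + -s * dv) + d * (-d * sh + -s * sv) - d ^ 3 * C =
      s * R₁ - d * R₂ := by
    rw [hR₁, hR₂]
    linear_combination dv * hdet
  have e2 : -sv - a * (-d * dh + -s * dv) + s * (-d * sh + -s * sv) - s * d ^ 2 * C =
      a * R₁ - s * R₂ := by
    rw [hR₁, hR₂]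
    linear_combination sv * hdet
  rw [e1, e2]
  constructor
  · rintro ⟨h1, h2⟩
    have r1 : R₁ = 0 := by linear_combination (-s) * h1 + d * h2 - R₁ * hdet
    have r2 : R₂ = 0 := by linear_combination (-a) * h1 + s * h2 - R₂ * hdet
    simp [r1, r2]
  · rintro ⟨h1, h2⟩
    have r1 : R₁ = 0 := by
      simp only [Complex.zero_im, div_eq_zero_iff, neg_eq_zero] at h2
      exact h2.resolve_right (pow_ne_zero _ hd0)
    have r2 : R₂ = 0 := by
      rw [r1] at h1
      simp only [mul_zero, zero_div, sub_zero, Complex.zero_re, div_eq_zero_iff] at h1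
      exact h1.resolve_right (pow_ne_zero _ hd0)
    simp [r1, r2]

end IsotropicEquation

/-! ### The pointwise criterion and its coordinate form. -/

section Euclidean

variable {n : ℕ} {m : EuclideanSpace ℝ (Fin n) → EuclideanSpace ℝ (Fin n)}
  {a d s : EuclideanSpace ℝ (Fin n) × EuclideanSpace ℝ (Fin n) → ℝ}
  {q : EuclideanSpace ℝ (Fin n) × EuclideanSpace ℝ (Fin n)}

/-- Antilinearity reduces the tensor to vertical pairs, where it is governed by two linear forms
that must both vanish since n ≥ 2. -/
theorem nijenhuis_isotropicEndo_eq_zero_iff (hn : 2 ≤ n) {c : ℝ}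
    (hJ : DifferentiableAt ℝ (isotropicEndo m a d s) q) (hm : DifferentiableAt ℝ m q.1)
    (hd : DifferentiableAt ℝ d q) (hs : DifferentiableAt ℝ s q)
    (hdet : ∀ᶠ q in nhds q, a q * d q - s q ^ 2 = 1)
    (hcurv : ∀ w u v,
      (conformalGamma (m q.1) w (conformalGamma (m q.1) u v)
        + conformalGamma (fderiv ℝ m q.1 w) u v)
      - (conformalGamma (m q.1) u (conformalGamma (m q.1) w v)
        + conformalGamma (fderiv ℝ m q.1 u) w v) = (c * inner ℝ u v) • w - (c * inner ℝ w v) • u) :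
    (∀ X Y, nijenhuis (isotropicEndo m a d s) q X Y = 0) ↔
      ∀ i, fderiv ℝ (isotropicZ d s) q (liftVector (m q.1) q.2 (EuclideanSpace.single i 1) 0)
        + isotropicZ d s q * fderiv ℝ (isotropicZ d s) q (0, EuclideanSpace.single i 1)
        + ((c * q.2 i : ℝ) : ℂ) = 0 := by
  set ι := ContinuousLinearMap.inr ℝ (EuclideanSpace ℝ (Fin n)) (EuclideanSpace ℝ (Fin n))
  set Jι := (isotropicEndo m a d s q).comp ι
  set A : EuclideanSpace ℝ (Fin n) →L[ℝ] ℝ := -(fderiv ℝ d q).comp ι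
    - s q • (fderiv ℝ d q).comp Jι + d q • (fderiv ℝ s q).comp Jι - (d q ^ 3 * c) • innerSL ℝ q.2
    with hA
  set B : EuclideanSpace ℝ (Fin n) →L[ℝ] ℝ := -(fderiv ℝ s q).comp ι
    - a q • (fderiv ℝ d q).comp Jι + s q • (fderiv ℝ s q).comp Jι
    - (s q * d q ^ 2 * c) • innerSL ℝ q.2 with hB
  have eA : (A : EuclideanSpace ℝ (Fin n) → ℝ) = fun u =>
      -fderiv ℝ d q (0, u) - s q * fderiv ℝ d q (isotropicEndo m a d s q (0, u))
      + d q * fderiv ℝ s q (isotropicEndo m a d s q (0, u)) - d q ^ 3 * c * inner ℝ u q.2 := by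
    funext u
    simp [hA, Jι, ι]
    exact Or.inl (real_inner_comm _ _)
  have eB : (B : EuclideanSpace ℝ (Fin n) → ℝ) = fun u =>
      -fderiv ℝ s q (0, u) - a q * fderiv ℝ d q (isotropicEndo m a d s q (0, u))
      + s q * fderiv ℝ s q (isotropicEndo m a d s q (0, u))
      - s q * d q ^ 2 * c * inner ℝ u q.2 := by
    funext u
    simp [hB, Jι, ι]
    exact Or.inl (real_inner_comm _ _)
  have key : ∀ i, (A (EuclideanSpace.single i 1) = 0 ∧ B (EuclideanSpace.single i 1) = 0) ↔
      fderiv ℝ (isotropicZ d s) q (liftVector (m q.1) q.2 (EuclideanSpace.single i 1) 0)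
        + isotropicZ d s q * fderiv ℝ (isotropicZ d s) q (0, EuclideanSpace.single i 1)
        + ((c * q.2 i : ℝ) : ℂ) = 0 := by
    intro i
    have := isotropic_equations_iff (c := c) (m := m) (a := a) hd hs hdet.self_of_nhds
      (EuclideanSpace.single i 1)
    simp only [EuclideanSpace.inner_single_left, map_one, one_mul] at this
    rw [← this, eA, eB]
    simp only [EuclideanSpace.inner_single_left, map_one, one_mul]
  simp_rw [← key, forall_and]
  rw [← forall_smul_sub_smul_eq_zero_iff hn, ← forall_smul_sub_smul_eq_zero_iff hn]
  have hv := nijenhuis_isotropicEndo_vertical hJ hm hd hs hcurv A B eA eB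
  constructor
  · intro h
    have h' : ∀ u v, A u • v - A v • u = 0 ∧ B u • v - B v • u = 0 := by
      intro u v
      have := (hv u v).symm.trans (h _ _)
      have h1 : A u • v - A v • u = 0 := congrArg Prod.fst this
      rw [h1, liftVector_zero] at this
      exact ⟨h1, congrArg Prod.snd this⟩
    exact ⟨fun u v => (h' u v).1, fun u v => (h' u v).2⟩
  · rintro ⟨h1, h2⟩
    have hd0 : d q ≠ 0 := by
      intro h
      have := hdet.self_of_nhds
      rw [h] at this
      nlinarith [sq_nonneg (s q)]
    refine nijenhuis_eq_zero_of_forall_mem hJ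
      (hdet.mono fun x hx v => isotropicEndo_isotropicEndo hx v) {p | p.1 = 0} ?_ ?_
    · intro p
      -- J(0, v) has horizontal part -d v, so this choice of v matches `p.1` and leaves a vertical
      -- remainder.
      refine ⟨p - isotropicEndo m a d s q (0, -(d q)⁻¹ • p.1), ?_,
        (0, -(d q)⁻¹ • p.1), rfl, by simp⟩
      simp [isotropicEndo_vertical, smul_smul, hd0]
    · rintro ⟨_, u⟩ rfl ⟨_, v⟩ rfl
      rw [hv u v, h1, h2, liftVector_zero]
      rfl

/-- The horizontal lift of ∂/∂x^i is ∂/∂x^i - ∑ Γ(e_i, y)^j ∂/∂y^j, with Γ(e_i, y)^j = ⟨g, y⟩δ_ij +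
g_i y_j - y_i g_j. -/
theorem isotropic_equation_iff_coord {c : ℝ} (i : Fin n)
    (Z : EuclideanSpace ℝ (Fin n) × EuclideanSpace ℝ (Fin n) → ℂ)
    (x y g : EuclideanSpace ℝ (Fin n)) :
    (fderiv ℝ Z (x, y) (liftVector g y (EuclideanSpace.single i 1) 0)
        + Z (x, y) * fderiv ℝ Z (x, y) (0, EuclideanSpace.single i 1)
        + ((c * y i : ℝ) : ℂ) = 0) ↔
    ∑ j, (partialY j Z (x, y) * ((y i * g j - g i * y j : ℝ) : ℂ)
            - partialY i Z (x, y) * ((y j * g j : ℝ) : ℂ))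
          = -((y i * c : ℝ) : ℂ) - (partialX i Z (x, y) + Z (x, y) * partialY i Z (x, y)) := by
  set D := fderiv ℝ Z (x, y)
  have hsum : ∀ v : EuclideanSpace ℝ (Fin n),
      D (0, v) = ∑ j, (v j : ℂ) * partialY j Z (x, y) := by
    intro v
    have : ((0 : EuclideanSpace ℝ (Fin n)), v) = ∑ j, v j • (0, EuclideanSpace.single j (1 : ℝ)) := by
      have := (EuclideanSpace.basisFun (Fin n) ℝ).sum_repr v
      apply Prod.ext
      · simp [Prod.fst_sum]
      · rw [Prod.snd_sum]
        simpa using this.symm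
    rw [this, map_sum]
    simp only [map_smul, Complex.real_smul]
    rfl
  have e : liftVector g y (EuclideanSpace.single i 1) 0 =
      (EuclideanSpace.single i 1, 0) + (0, -conformalGamma g (EuclideanSpace.single i 1) y) := by
    simp [liftVector]
  rw [e, map_add, hsum (-_)]
  have hin : (inner ℝ g y : ℝ) = ∑ j, y j * g j := by
    simp [PiLp.inner_apply]
  have h2 : ∑ j, (((-conformalGamma g (EuclideanSpace.single i 1) y) j : ℝ) : ℂ)
      * partialY j Z (x, y) = ∑ j, (partialY j Z (x, y) * ((y i * g j - g i * y j : ℝ) : ℂ)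
            - partialY i Z (x, y) * ((y j * g j : ℝ) : ℂ)) := by
    rw [Finset.sum_sub_distrib, ← Finset.mul_sum]
    -- The summand ⟨g, y⟩ occurs only at j = i; the target equation spreads it over the sum as ∑ y_j
    -- g_j.
    have : ∀ j, (((-conformalGamma g (EuclideanSpace.single i 1) y) j : ℝ) : ℂ)
      * partialY j Z (x, y) = partialY j Z (x, y) * ((y i * g j - g i * y j : ℝ) : ℂ) -
        if j = i then partialY j Z (x, y) * ((inner ℝ g y : ℝ) : ℂ) else 0 := by
      intro j
      split_ifs with h <;>
      · simp [conformalGamma, h, EuclideanSpace.inner_single_left, EuclideanSpace.inner_single_right]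
        ring
    simp_rw [this]
    rw [Finset.sum_sub_distrib, Finset.sum_ite_eq' Finset.univ i, hin]
    simp
  rw [h2]
  have hX : D (EuclideanSpace.single i 1, 0) = partialX i Z (x, y) := rfl
  have hY : D (0, EuclideanSpace.single i 1) = partialY i Z (x, y) := rfl
  rw [hX, hY]
  constructor
  · intro h
    push_cast at h ⊢
    linear_combination h
  · intro h
    push_cast at h ⊢
    linear_combination h

end Euclidean

/-! ### The coordinates (x, y) on the tangent bundle of the sphere. -/

section BundleCoordinates

/-- The coordinate space. -/
abbrev Euc (n : ℕ) : Type := EuclideanSpace ℝ (Fin n)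

variable {n : ℕ}

theorem contMDiff_tangentBundle_mk :
    ContMDiff 𝓘(ℝ, Euc n × Euc n) (𝓡 n).tangent ∞
      (fun q : Euc n × Euc n => (⟨q.1, q.2⟩ : TangentBundle 𝓘(ℝ, Euc n) (Euc n))) := by
  intro q
  rw [← contMDiffWithinAt_univ, Bundle.contMDiffWithinAt_totalSpace]
  refine ⟨contDiff_fst.contMDiff.contMDiffAt, ?_⟩
  have : ContMDiff 𝓘(ℝ, Euc n × Euc n) 𝓘(ℝ, Euc n) ∞ (fun q : Euc n × Euc n => q.2) :=
    contDiff_snd.contMDiff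
  convert! this.contMDiffAt.contMDiffWithinAt with y
  · simp
    rfl

theorem contMDiff_coe_sph {k : WithTop ℕ∞} :
    ContMDiff (𝓡 n) 𝓘(ℝ, EuclideanSpace ℝ (Fin (n + 1))) k
      (fun q : Sph n => (q : EuclideanSpace ℝ (Fin (n + 1)))) := by
  have := Fact.mk (@finrank_euclideanSpace_fin ℝ _ (n + 1))
  exact contMDiff_coe_sphere

/-- This map is the fibre component of the tangent map of the inclusion into ℝ^{n+1}. -/
theorem contMDiff_fibreVector :
    ContMDiff (𝓡 n).tangent 𝓘(ℝ, Euc (n + 1)) ∞ (fun w : TSph n => fibreVector w) := by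
  have h1 := contMDiff_coe_sph (n := n) (k := ∞)
  exact (contMDiff_snd_tangentBundle_modelSpace (Euc (n + 1)) 𝓘(ℝ, Euc (n + 1))).comp
    (h1.contMDiff_tangentMap (m := ∞) (by simp))

variable {e : OpenPartialHomeomorph (Sph n) (Euc n)}

/-- The coordinates `(x, y)` on `TU` associated with the chart `e`. -/
def bundleCoord (e : OpenPartialHomeomorph (Sph n) (Euc n)) (w : TSph n) : Euc n × Euc n :=
  (e w.proj, mfderiv (𝓡 n) 𝓘(ℝ, Euc n) e w.proj w.2)

variable (he : e ∈ IsManifold.maximalAtlas (𝓡 n) ∞ (Sph n))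
include he

theorem mdifferentiableAt_chart_symm {x : Euc n} (hx : x ∈ e.target) :
    MDifferentiableAt 𝓘(ℝ, Euc n) (𝓡 n) e.symm x :=
  ((contMDiffOn_symm_of_mem_maximalAtlas he).contMDiffAt
    (e.open_target.mem_nhds hx)).mdifferentiableAt (by simp)

theorem mfderiv_chart_facts {x : Euc n} (hx : x ∈ e.target) :
    (∀ v : Euc n, (mfderiv (𝓡 n) 𝓘(ℝ, Euc n) e (e.symm x)
      (mfderiv 𝓘(ℝ, Euc n) (𝓡 n) e.symm x v) : Euc n) = v) ∧
    ∀ v, mfderiv 𝓘(ℝ, Euc n) (𝓡 n) e.symm x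
      (mfderiv (𝓡 n) 𝓘(ℝ, Euc n) e (e.symm x) v : Euc n) = v := by
  have hs := e.map_target hx
  have d : MDifferentiableAt (𝓡 n) 𝓘(ℝ, Euc n) e (e.symm x) :=
    ((contMDiffOn_of_mem_maximalAtlas he).contMDiffAt
      (e.open_source.mem_nhds hs)).mdifferentiableAt (by simp)
  exact (isInvertible_mfderiv_of_local_inverse rfl (e.right_inv hx)
    (mdifferentiableAt_chart_symm he hx) d (e.eventually_right_inverse hx)
    (e.eventually_left_inverse hs)).2

theorem contMDiffOn_bundlePoint :
    ContMDiffOn 𝓘(ℝ, Euc n × Euc n) (𝓡 n).tangent ∞ (bundlePoint e) (e.target ×ˢ Set.univ) := by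
  have h1 := (contMDiffOn_symm_of_mem_maximalAtlas he).contMDiffOn_tangentMapWithin (m := ∞)
    (by simp) e.open_target.uniqueMDiffOn
  have h2 := h1.comp (t := Bundle.TotalSpace.proj ⁻¹' e.target) (s := e.target ×ˢ Set.univ)
    (contMDiff_tangentBundle_mk (n := n)).contMDiffOn (fun q hq => hq.1)
  refine h2.congr fun q hq => ?_
  have : mfderivWithin 𝓘(ℝ, Euc n) (𝓡 n) e.symm e.target q.1 =
      mfderiv 𝓘(ℝ, Euc n) (𝓡 n) e.symm q.1 := mfderivWithin_of_isOpen e.open_target hq.1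
  simp only [Function.comp_apply, tangentMapWithin, this]
  rfl

theorem contMDiffOn_bundleCoord :
    ContMDiffOn (𝓡 n).tangent 𝓘(ℝ, Euc n × Euc n) ∞ (bundleCoord e) (bundleOver e.source) := by
  have h0 := contMDiffOn_of_mem_maximalAtlas he
  have h1 := h0.contMDiffOn_tangentMapWithin (m := ∞)
    (by simp) e.open_source.uniqueMDiffOn
  have h2 := (contMDiff_snd_tangentBundle_modelSpace (Euc n) 𝓘(ℝ, Euc n)).comp_contMDiffOn h1
  have h3 : ContMDiffOn (𝓡 n).tangent 𝓘(ℝ, Euc n) ∞ (fun w : TSph n => e w.proj)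
      (bundleOver e.source) :=
    h0.comp (Bundle.contMDiff_proj (TangentSpace (𝓡 n))).contMDiffOn (fun w hw => hw)
  refine h3.prodMk_space (h2.congr fun w hw => ?_)
  have : mfderivWithin (𝓡 n) 𝓘(ℝ, Euc n) e e.source w.proj =
      mfderiv (𝓡 n) 𝓘(ℝ, Euc n) e w.proj := mfderivWithin_of_isOpen e.open_source hw
  exact (congrArg (fun L => (L w.2 : Euc n)) this).symm

theorem isDiffeoOn_bundlePoint : IsDiffeoOn (𝓡 n).tangent (bundlePoint e) (bundleCoord e)
    (e.target ×ˢ Set.univ) (bundleOver e.source) where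
  isOpen_source := e.open_target.prod isOpen_univ
  isOpen_target := e.open_source.preimage
    (FiberBundle.continuous_proj (Euc n) (TangentSpace (𝓡 n)))
  mapsTo := fun q hq => e.map_target hq.1
  mapsTo_inv := fun w hw => ⟨e.map_source hw, trivial⟩
  left_inv := fun q hq => Prod.ext (e.right_inv hq.1) ((mfderiv_chart_facts he hq.1).1 q.2)
  right_inv := by
    rintro ⟨p, v⟩ hp
    -- Writing the base point as `e.symm x` makes the fibres on both sides literally the same.
    obtain ⟨x, hx, rfl⟩ : ∃ x ∈ e.target, e.symm x = p :=
      ⟨e p, e.map_source hp, e.left_inv hp⟩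
    have h1 : bundleCoord e ⟨e.symm x, v⟩ =
        (x, mfderiv (𝓡 n) 𝓘(ℝ, Euc n) e (e.symm x) v) := Prod.ext (e.right_inv hx) rfl
    rw [h1]
    exact congrArg (Bundle.TotalSpace.mk (e.symm x)) ((mfderiv_chart_facts he hx).2 v)
  smooth := contMDiffOn_bundlePoint he
  smooth_inv := contMDiffOn_bundleCoord he

/-- The inverse of the chart `e`, as a map to `ℝ^{n+1}`. -/
def sphereParam (e : OpenPartialHomeomorph (Sph n) (Euc n)) (x : Euc n) : Euc (n + 1) := e.symm x

omit he in
theorem mdifferentiableAt_coe_sphere (p : Sph n) :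
    MDifferentiableAt (𝓡 n) 𝓘(ℝ, Euc (n + 1)) (fun q : Sph n => (q : Euc (n + 1))) p :=
  (contMDiff_coe_sph (k := ∞) p).mdifferentiableAt (by simp)

theorem fderiv_sphereParam {x : Euc n} (hx : x ∈ e.target) (u : Euc n) :
    fderiv ℝ (sphereParam e) x u =
      dIncl (e.symm x) (mfderiv 𝓘(ℝ, Euc n) (𝓡 n) e.symm x u) := by
  rw [← mfderiv_eq_fderiv]
  have := mfderiv_comp x (mdifferentiableAt_coe_sphere (e.symm x))
    (mdifferentiableAt_chart_symm he hx)
  exact congrArg (fun L => L u) this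

theorem contDiffOn_sphereParam : ContDiffOn ℝ ∞ (sphereParam e) e.target := by
  have h1 := contMDiff_coe_sph (n := n) (k := ∞)
  exact (h1.comp_contMDiffOn (contMDiffOn_symm_of_mem_maximalAtlas he)).contDiffOn

omit he in
theorem isConformalSphereMap_sphereParam {lam : Sph n → ℝ} (he : IsConformallyFlatChart e lam) :
    IsConformalSphereMap (sphereParam e) (fun x => lam (e.symm x)) e.target where
  isOpen := e.open_target
  smooth := contDiffOn_sphereParam he.1
  inner_self := fun x _ => by
    have : ‖(e.symm x : Euc (n + 1))‖ = 1 := by simp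
    rw [real_inner_self_eq_norm_sq, sphereParam, this, one_pow]
  pos := fun x hx => (he.2 _ (e.map_target hx)).1
  inner_fderiv := fun x hx u v => by
    have h1 := (he.2 _ (e.map_target hx)).2 (mfderiv 𝓘(ℝ, Euc n) (𝓡 n) e.symm x u)
      (mfderiv 𝓘(ℝ, Euc n) (𝓡 n) e.symm x v)
    rw [fderiv_sphereParam he.1 hx, fderiv_sphereParam he.1 hx]
    refine h1.trans ?_
    have h2 : ∀ u : Euc n, mvfderiv (𝓡 n) e (e.symm x)
        (mfderiv 𝓘(ℝ, Euc n) (𝓡 n) e.symm x u) = u := (mfderiv_chart_facts he.1 hx).1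
    rw [h2, h2]
    simp [PiLp.inner_apply, mul_comm]

end BundleCoordinates

/-- Horizontal and vertical lifts span, so the two defining relations of J determine it. The target
is an abstract `V`, which keeps tangent-space types out of the computation. -/
theorem intertwines_isotropicEndo {E V : Type*} [NormedAddCommGroup E] [InnerProductSpace ℝ E]
    [AddCommGroup V] [Module ℝ V] [TopologicalSpace V] {m : E → E} {a d s : E × E → ℝ} {q : E × E}
    (D : E × E →L[ℝ] V) (T : V →L[ℝ] V)
    (hh : ∀ h, T (D (liftVector (m q.1) q.2 h 0)) =
      a q • D (0, h) + s q • D (liftVector (m q.1) q.2 h 0))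
    (hv : ∀ h, T (D (0, h)) = -(s q • D (0, h)) - d q • D (liftVector (m q.1) q.2 h 0))
    (ξ : E × E) : T (D ξ) = D (isotropicEndo m a d s q ξ) := by
  have hlift : ∀ h k, liftVector (m q.1) q.2 h k = liftVector (m q.1) q.2 h 0 + (0, k) := by
    intro h k
    rw [← liftVector_zero (m q.1) q.2, liftVector_add, add_zero, zero_add]
  have hD : ∀ h k, D (liftVector (m q.1) q.2 h k) =
      D (liftVector (m q.1) q.2 h 0) + D (0, k) := fun h k => by rw [hlift, map_add]
  have hsub : ∀ (x y : ℝ) h k, D (0, x • h - y • k) = x • D (0, h) - y • D (0, k) := by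
    intro x y h k
    rw [← map_smul, ← map_smul, ← map_sub]
    simp
  have hsub' : ∀ (x y : ℝ) h k, D (liftVector (m q.1) q.2 (x • h - y • k) 0) =
      x • D (liftVector (m q.1) q.2 h 0) - y • D (liftVector (m q.1) q.2 k 0) := by
    intro x y h k
    rw [← map_smul, ← map_smul, ← map_sub, liftVector_smul, liftVector_smul, liftVector_sub]
    simp
  rw [eq_liftVector (m q.1) q.2 ξ, isotropicEndo_liftVector, hD, hD (s q • _ - _), map_add, hh, hv, hsub, hsub']
  module

/-! ### Horizontal and vertical lifts in coordinates. -/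

section Lifts

variable {n : ℕ} {e : OpenPartialHomeomorph (Sph n) (Euc n)}

/-- The differential of the parametrization `bundlePoint e`. -/
def dBundlePoint (e : OpenPartialHomeomorph (Sph n) (Euc n)) (q : Euc n × Euc n) :
    Euc n × Euc n →L[ℝ] TangentSpace (𝓡 n).tangent (bundlePoint e q) :=
  mfderiv 𝓘(ℝ, Euc n × Euc n) (𝓡 n).tangent (bundlePoint e) q

section

variable (he : e ∈ IsManifold.maximalAtlas (𝓡 n) ∞ (Sph n)) {q : Euc n × Euc n}
  (hq : q ∈ e.target ×ˢ (Set.univ : Set (Euc n)))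
include he hq

theorem mdifferentiableAt_bundlePoint :
    MDifferentiableAt 𝓘(ℝ, Euc n × Euc n) (𝓡 n).tangent (bundlePoint e) q :=
  ((contMDiffOn_bundlePoint he).contMDiffAt
    ((e.open_target.prod isOpen_univ).mem_nhds hq)).mdifferentiableAt (by simp)

theorem dProj_dBundlePoint (ξ : Euc n × Euc n) :
    dProj (bundlePoint e q) (dBundlePoint e q ξ) =
      mfderiv 𝓘(ℝ, Euc n) (𝓡 n) e.symm q.1 ξ.1 := by
  have d : MDifferentiableAt (𝓡 n).tangent (𝓡 n) (fun w : TSph n => w.proj) (bundlePoint e q) :=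
    (Bundle.contMDiff_proj (n := ∞) (IB := 𝓡 n) (TangentSpace (𝓡 n) (M := Sph n))
      (bundlePoint e q)).mdifferentiableAt (by simp)
  have h1 := mfderiv_comp q d (mdifferentiableAt_bundlePoint he hq)
  have h2 := mfderiv_comp (I := 𝓘(ℝ, Euc n × Euc n)) (I' := 𝓘(ℝ, Euc n)) q
    (mdifferentiableAt_chart_symm he hq.1) (f := Prod.fst)
    differentiableAt_fst.mdifferentiableAt
  have h3 : mfderiv 𝓘(ℝ, Euc n × Euc n) 𝓘(ℝ, Euc n) (Prod.fst : Euc n × Euc n → Euc n) q =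
      ContinuousLinearMap.fst ℝ (Euc n) (Euc n) := mfderiv_eq_fderiv.trans fderiv_fst
  exact (congrArg (fun L => (L ξ : Euc n)) (h1.symm.trans h2)).trans
    (congrArg (fun L : Euc n × Euc n →L[ℝ] Euc n =>
      (mfderiv 𝓘(ℝ, Euc n) (𝓡 n) e.symm q.1 (L ξ) : Euc n)) h3)

/-- In coordinates the fibre vector is DF(x)y, to which the product rule applies. -/
theorem mvfderiv_fibreVector_dBundlePoint (ξ : Euc n × Euc n) :
    mvfderiv (𝓡 n).tangent (fun w' : TSph n => fibreVector w') (bundlePoint e q)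
      (dBundlePoint e q ξ) =
      fderiv ℝ (fderiv ℝ (sphereParam e)) q.1 ξ.1 q.2 + fderiv ℝ (sphereParam e) q.1 ξ.2 := by
  have d : MDifferentiableAt (𝓡 n).tangent 𝓘(ℝ, Euc (n + 1)) (fun w : TSph n => fibreVector w)
      (bundlePoint e q) := (contMDiff_fibreVector _).mdifferentiableAt (by simp)
  have h1 := mfderiv_comp q d (mdifferentiableAt_bundlePoint he hq)
  have h2 : (fun w : TSph n => fibreVector w) ∘ bundlePoint e =ᶠ[nhds q]
      fun q => fderiv ℝ (sphereParam e) q.1 q.2 := by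
    filter_upwards [(e.open_target.prod isOpen_univ).mem_nhds hq] with p hp
    rw [fderiv_sphereParam he hp.1]
    rfl
  have h3 : HasFDerivAt (fderiv ℝ (sphereParam e)) _ q.1 :=
    ((((contDiffOn_sphereParam he).fderiv_of_isOpen e.open_target (m := ∞) (by simp)).contDiffAt
      (e.open_target.mem_nhds hq.1)).differentiableAt (by simp)).hasFDerivAt
  have h4 : HasFDerivAt (fun q : Euc n × Euc n => fderiv ℝ (sphereParam e) q.1 q.2) _ q :=
    (HasFDerivAt.comp q h3 hasFDerivAt_fst).clm_apply hasFDerivAt_snd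
  have h5 := congrArg (fun L => (L ξ : Euc (n + 1))) h1
  refine h5.symm.trans ?_
  have h6 := mfderiv_eq_fderiv (𝕜 := ℝ) (f := (fun w : TSph n => fibreVector w) ∘ bundlePoint e)
    (x := q)
  refine (congrArg (fun L => (L ξ : Euc (n + 1))) h6).trans ?_
  rw [h2.fderiv_eq, h4.fderiv]
  exact add_comm _ _

end

variable {lam : Sph n → ℝ} (he : IsConformallyFlatChart e lam) {q : Euc n × Euc n}
  (hq : q ∈ e.target ×ˢ (Set.univ : Set (Euc n))) [Nontrivial (Euc n)]
include he hq

/-- By the Gauss formula the tangential part of D²F(h, y) is DF(Γ(h, y)), which cancels the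
correction in `liftVector`; the normal part is removed by the projection. This identifies the
extrinsic connection with the Christoffel symbols. -/
theorem connectionMap_dBundlePoint (h k : Euc n) :
    connectionMap (bundlePoint e q) (dBundlePoint e q
      (liftVector (logGrad (fun x => lam (e.symm x)) q.1) q.2 h k)) =
      fderiv ℝ (sphereParam e) q.1 k := by
  have hF := isConformalSphereMap_sphereParam he
  have hdim : Module.finrank ℝ (EuclideanSpace ℝ (Fin (n + 1))) = Module.finrank ℝ (Euc n) + 1 := by
    simp
  rw [connectionMap, mvfderiv_fibreVector_dBundlePoint he.1 hq, hF.gauss_formula hdim hq.1]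
  simp only [liftVector, map_sub, tangentialPart]
  have hp : (((bundlePoint e q).proj : Sph n) : EuclideanSpace ℝ (Fin (n + 1))) =
    sphereParam e q.1 := rfl
  have ho : ∀ u, inner ℝ (sphereParam e q.1) (fderiv ℝ (sphereParam e) q.1 u) = 0 := fun u => by
    rw [real_inner_comm]
    exact hF.inner_fderiv_self hq.1 u
  rw [hp]
  simp only [inner_add_right, inner_sub_right, real_inner_smul_right, ho, hF.inner_self _ hq.1]
  module

theorem isHorizontalLift_dBundlePoint (h : Euc n) :
    IsHorizontalLift (bundlePoint e q) (mfderiv 𝓘(ℝ, Euc n) (𝓡 n) e.symm q.1 h)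
      (dBundlePoint e q (liftVector (logGrad (fun x => lam (e.symm x)) q.1) q.2 h 0)) :=
  ⟨by rw [connectionMap_dBundlePoint he hq, map_zero], dProj_dBundlePoint he.1 hq _⟩

theorem isVerticalLift_dBundlePoint (k : Euc n) :
    IsVerticalLift (bundlePoint e q) (mfderiv 𝓘(ℝ, Euc n) (𝓡 n) e.symm q.1 k)
      (dBundlePoint e q (0, k)) := by
  constructor
  · rw [dProj_dBundlePoint he.1 hq]
    exact map_zero (mfderiv 𝓘(ℝ, Euc n) (𝓡 n) e.symm q.1)
  · rw [← liftVector_zero (logGrad (fun x => lam (e.symm x)) q.1) q.2,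
      connectionMap_dBundlePoint he hq, fderiv_sphereParam he.1 hq.1]
    rfl

theorem isotropic_dBundlePoint {α δ σ : TSph n → ℝ}
    {J : ∀ w : TSph n, TangentSpace (𝓡 n).tangent w →L[ℝ] TangentSpace (𝓡 n).tangent w}
    (hJ : IsIsotropicOn J α δ σ (bundleOver e.source)) (ξ : Euc n × Euc n) :
    J (bundlePoint e q) (dBundlePoint e q ξ) = dBundlePoint e q
      (isotropicEndo (logGrad (fun x => lam (e.symm x))) (fun q => α (bundlePoint e q))
        (fun q => δ (bundlePoint e q)) (fun q => σ (bundlePoint e q)) q ξ) := by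
  have hw : bundlePoint e q ∈ bundleOver e.source := e.map_target hq.1
  exact intertwines_isotropicEndo (m := logGrad (fun x => lam (e.symm x)))
    (a := fun q => α (bundlePoint e q)) (d := fun q => δ (bundlePoint e q))
    (s := fun q => σ (bundlePoint e q)) (V := TangentSpace (𝓡 n).tangent (bundlePoint e q))
    (dBundlePoint e q) (J (bundlePoint e q))
    (fun h => hJ.map_horizontal _ hw _ _ _ (isHorizontalLift_dBundlePoint he hq h)
      (isVerticalLift_dBundlePoint he hq h))
    (fun h => hJ.map_vertical _ hw _ _ _ (isHorizontalLift_dBundlePoint he hq h)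
      (isVerticalLift_dBundlePoint he hq h)) ξ

end Lifts

end


/-! ### The main theorem. -/

theorem mainTheorem6 (n : ℕ) (hn : 2 ≤ n)
    (e : OpenPartialHomeomorph (Sph n) (EuclideanSpace ℝ (Fin n))) (lam : Sph n → ℝ)
    (he : IsConformallyFlatChart e lam)
    (α δ σ : TSph n → ℝ)
    (J : ∀ w : TSph n, TangentSpace (𝓡 n).tangent w →L[ℝ] TangentSpace (𝓡 n).tangent w)
    (hJ : IsIsotropicOn J α δ σ (bundleOver e.source)) :
    IsIntegrableOn J (bundleOver e.source) ↔
      ∀ x ∈ e.target, ∀ y : EuclideanSpace ℝ (Fin n), ∀ s₀ : Fin n,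
        ∑ i, (partialY i (zCoord e δ σ) (x, y) *
              ((y s₀ * muCoeff e lam i x - muCoeff e lam s₀ x * y i : ℝ) : ℂ)
            - partialY s₀ (zCoord e δ σ) (x, y) * ((y i * muCoeff e lam i x : ℝ) : ℂ))
          = -((y s₀ * lam (e.symm x) ^ 2 : ℝ) : ℂ)
            - (partialX s₀ (zCoord e δ σ) (x, y)
              + zCoord e δ σ (x, y) * partialY s₀ (zCoord e δ σ) (x, y)) := by
  have : Nontrivial (Fin n) := Fin.nontrivial_iff_two_le.2 hn
  have : Nontrivial (Euc n) := inferInstanceAs (Nontrivial (EuclideanSpace ℝ (Fin n)))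
  have hF := isConformalSphereMap_sphereParam he
  have hΦ := isDiffeoOn_bundlePoint he.1
  set g := logGrad (fun x => lam (e.symm x)) with hg
  have sm : ∀ {f : TSph n → ℝ}, ContMDiffOn (𝓡 n).tangent 𝓘(ℝ, ℝ) ∞ f (bundleOver e.source) →
      ContDiffOn ℝ ∞ (fun q => f (bundlePoint e q)) (e.target ×ˢ (Set.univ : Set (Euc n))) :=
    fun hf => (hf.comp hΦ.smooth hΦ.mapsTo).contDiffOn
  have sα := sm hJ.smooth_α
  have sδ := sm hJ.smooth_δ
  have sσ := sm hJ.smooth_σ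
  have hdet : ∀ q ∈ e.target ×ˢ (Set.univ : Set (Euc n)),
      α (bundlePoint e q) * δ (bundlePoint e q) - σ (bundlePoint e q) ^ 2 = 1 :=
    fun q hq => hJ.det_eq_one _ (hΦ.mapsTo hq)
  have sJ := contDiffOn_isotropicEndo (Ω := e.target ×ˢ (Set.univ : Set (Euc n)))
    (fun q hq => hq.1) hF.contDiffOn_logGrad sα sδ sσ
  rw [hΦ.isIntegrableOn_iff_nijenhuis sJ
    (fun q hq v => isotropicEndo_isotropicEndo (hdet q hq) v)
    (fun q hq v => isotropic_dBundlePoint he hq hJ v)]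
  have hdim : Module.finrank ℝ (EuclideanSpace ℝ (Fin (n + 1))) = Module.finrank ℝ (Euc n) + 1 := by
    simp
  -- The Gauss equation supplies the curvature hypothesis with constant c = λ² at the base point.
  have key : ∀ q ∈ e.target ×ˢ (Set.univ : Set (Euc n)), _ ↔ _ := fun q hq => by
    have hn' := hΦ.isOpen_source.mem_nhds hq
    exact nijenhuis_isotropicEndo_eq_zero_iff hn ((sJ.contDiffAt hn').differentiableAt (by simp))
      (hF.hasFDerivAt_logGrad hq.1).differentiableAt
      ((sδ.contDiffAt hn').differentiableAt (by simp))
      ((sσ.contDiffAt hn').differentiableAt (by simp))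
      (Filter.eventually_of_mem hn' hdet) (hF.gauss_equation hdim hq.1)
  have hmu : ∀ i x, muCoeff e lam i x = g x i := by
    intro i x
    have := inner_logGrad (fun x => lam (e.symm x)) x (EuclideanSpace.single i 1)
    rw [EuclideanSpace.inner_single_right] at this
    simpa [muCoeff] using this.symm
  -- `zCoord e δ σ` unfolds to `isotropicZ` of δ and σ in coordinates, so `coord` and `key` compose
  -- directly.
  have coord : ∀ x y i, _ ↔ _ := fun x y i =>
    isotropic_equation_iff_coord (c := lam (e.symm x) ^ 2) i (zCoord e δ σ) x y (g x)
  simp only [hmu]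
  constructor
  · intro h x hx y i
    exact (coord x y i).1 ((key (x, y) ⟨hx, trivial⟩).1 (h (x, y) ⟨hx, trivial⟩) i)
  · intro h q hq
    exact (key q hq).2 fun i => (coord q.1 q.2 i).2 (h q.1 hq.1 q.2 i)
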